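/- All entropies are Shannon entropies in bits and $\log=\log_2$. For $n,m\ge 1$ consider the structural causal model $Y=f(X,E)$ with $X$ independent of $E$, where $X$ takes values in $[n]$ with distribution $p(X)$, $E$ takes values in $[m]$, $Y$ takes values in $[n]$, and $f$ is sampled uniformly from all maps $[n]\times[m]\to[n]$. Fix a constant $c\ge 0$ and let $E$ have any distribution with $H(E)\le c$; there is no restriction on $m$. Suppose one of the following holds: (a) $p(X)$ is any distribution on $[n]$ with $\max_x p(x)\le\rho\,\min_x p(x)$, for a constant $\rho$; (b) $p(X)$ is sampled uniformly from the probability simplex $\Delta_n$, independently of $f$; (c) $p(X)$ is any distribution on $[n]$ with $H(X)\ge\log n-a$, for a constant $a$. Then there are a constant $C$, an integer $n_0$ and a sequence $\delta_n\to 0$, depending only on $(\rho,c)$ in case (a), on $c$ in case (b) and on $(a,c)$ in case (c), such that: (i) for all $n$, with probability at least $1-\delta_n$ (over $f$ in cases (a) and (c), over $p(X)$ and $f$ in case (b)), every discrete random variable $\tilde E$ that is independent of $Y$ and satisfies $X=g(Y,\tilde E)$ almost surely for some deterministic function $g$ has $H(\tilde E)\ge 0.25\log\log n-C$ (for $n=1$,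 where $\log\log n$ is not defined, nothing is claimed); (ii) for all $n\ge n_0$, with probability at least $1-\delta_n$, the causal direction is identifiable from the joint distribution of $(X,Y)$ by comparing exogenous entropies: the infimum of the entropies of exogenous variables over all structural causal models from $X$ to $Y$ that generate this joint distribution is at most $c$, whereas the infimum over all structural causal models from $Y$ to $X$ that generate it is strictly greater than $c$. -/

import Mathlib

open MeasureTheory ProbabilityTheory Filter Topology
open scoped ENNReal NNReal

/-- Shannon entropy in bits of the probability vector `p`, with `0 log 0 = 0`. Entropies are
extended nonnegative reals, since a countable alphabet allows infinite entropy. -/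
noncomputable def shannonEntropy {ι : Type*} (p : ι → ℝ) : ℝ≥0∞ :=
  ∑' i, ENNReal.ofReal (Real.negMulLog (p i) / Real.log 2)

/-- Shannon entropy in bits of the discrete random variable `Z`. -/
noncomputable def rvEntropy {Ω ι : Type*} [MeasurableSpace Ω] (μ : Measure Ω) (Z : Ω → ι) : ℝ≥0∞ :=
  shannonEntropy fun i => μ.real (Z ⁻¹' {i})

/-- The structural causal model `B = f(A, E)`, `A ⫫ E`, with cause `A`, effect `B` and exogenous
variable `E`. -/
structure IsSCM {Ω α β ι : Type*} [MeasurableSpace Ω] [MeasurableSpace α] [MeasurableSpace β]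
    [MeasurableSpace ι] (μ : Measure Ω) (A : Ω → α) (B : Ω → β) (E : Ω → ι) (f : α → ι → β) :
    Prop where
  measurable_cause : Measurable A
  measurable_effect : Measurable B
  measurable_noise : Measurable E
  indep : IndepFun A E μ
  effect_eq : ∀ᵐ ω ∂μ, B ω = f (A ω) (E ω)

/-- `(X, Y, E)` follows the structural causal model `Y = f(X, E)`, `X ⫫ E`, where `X ∈ [n]` has
distribution `p` and `E ∈ [m]` has distribution `q`. -/
structure RealizesModel {Ω : Type*} [MeasurableSpace Ω] {n m : ℕ} (μ : Measure Ω)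
    (X Y : Ω → Fin n) (E : Ω → Fin m) (p : Fin n → ℝ) (q : Fin m → ℝ)
    (f : Fin n → Fin m → Fin n) : Prop where
  scm : IsSCM μ X Y E f
  law_cause : ∀ i, μ.real (X ⁻¹' {i}) = p i
  law_noise : ∀ k, μ.real (E ⁻¹' {k}) = q k

/-- In the model `(p, q, f)`, every discrete `E'` that is independent of `Y` and satisfies
`X = g(Y, E')` for some deterministic `g` has entropy at least `b`. -/
def ReverseEntropyGE {n m : ℕ} (p : Fin n → ℝ) (q : Fin m → ℝ) (f : Fin n → Fin m → Fin n)
    (b : ℝ≥0∞) : Prop :=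
  ∀ (Ω : Type) [MeasurableSpace Ω] (μ : Measure Ω) [IsProbabilityMeasure μ]
    (X Y : Ω → Fin n) (E : Ω → Fin m), RealizesModel μ X Y E p q f →
    ∀ (ι : Type) [Countable ι] [MeasurableSpace ι] [DiscreteMeasurableSpace ι]
      (E' : Ω → ι) (g : Fin n → ι → Fin n), IsSCM μ Y X E' g → b ≤ rvEntropy μ E'

/-- The least exogenous entropy (as an infimum) over all structural causal models from the first
coordinate to the second one that generate the joint distribution `P`. -/
noncomputable def minExogenousEntropy {α β : Type*} [MeasurableSpace α] [MeasurableSpace β]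
    (P : Measure (α × β)) : ℝ≥0∞ :=
  sInf {h | ∃ (Ω : Type) (_ : MeasurableSpace Ω) (μ : Measure Ω) (_ : IsProbabilityMeasure μ)
    (ι : Type) (_ : Countable ι) (_ : MeasurableSpace ι) (_ : DiscreteMeasurableSpace ι)
    (A : Ω → α) (B : Ω → β) (E : Ω → ι) (f : α → ι → β),
    IsSCM μ A B E f ∧ μ.map (fun ω => (A ω, B ω)) = P ∧ h = rvEntropy μ E}

/-- The joint distribution `P` of `(X, Y)` identifies the direction `X → Y` by exogenous entropy:
entropy at most `c` suffices from `X` to `Y`, and more than `c` is needed from `Y` to `X`. In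
particular the minimum for `X → Y` is strictly smaller than that for `Y → X`. -/
def IdentifiesDirection {α β : Type*} [MeasurableSpace α] [MeasurableSpace β]
    (P : Measure (α × β)) (c : ℝ≥0∞) : Prop :=
  minExogenousEntropy P ≤ c ∧ c < minExogenousEntropy (P.map Prod.swap)

/-- In the model `(p, q, f)`, the joint distribution of `(X, Y)` identifies the direction
`X → Y`. -/
def ModelIdentifiable {n m : ℕ} (p : Fin n → ℝ) (q : Fin m → ℝ) (f : Fin n → Fin m → Fin n)
    (c : ℝ≥0∞) : Prop :=
  ∀ (Ω : Type) [MeasurableSpace Ω] (μ : Measure Ω) [IsProbabilityMeasure μ]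
    (X Y : Ω → Fin n) (E : Ω → Fin m), RealizesModel μ X Y E p q f →
    IdentifiesDirection (μ.map fun ω => (X ω, Y ω)) c

/-- The uniform distribution on all maps `[n] × [m] → [n]`. -/
noncomputable def uniformMap (n m : ℕ) : Measure (Fin n → Fin m → Fin n) :=
  uniformOn Set.univ

/-- The probability simplex as a subset of Euclidean space. -/
def euclideanSimplex (n : ℕ) : Set (EuclideanSpace ℝ (Fin n)) :=
  {x | x.ofLp ∈ stdSimplex ℝ (Fin n)}

/-- The uniform distribution on the probability simplex in `n` dimensions: the normalized
`(n - 1)`-dimensional surface measure on it. -/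
noncomputable def uniformSimplex (n : ℕ) : Measure (Fin n → ℝ) :=
  (cond (μHE[n - 1] : Measure (EuclideanSpace ℝ (Fin n))) (euclideanSimplex n)).map WithLp.ofLp

theorem isProbabilityMeasure_uniformSimplex {n : ℕ} (hn : 0 < n) :
    IsProbabilityMeasure (uniformSimplex n) := by
  obtain ⟨k, rfl⟩ : ∃ k, n = k + 1 := ⟨n - 1, by omega⟩
  -- it suffices to see that the simplex has positive finite surface measure
  suffices h : (μHE[k] : Measure (EuclideanSpace ℝ (Fin (k + 1)))) (euclideanSimplex (k + 1)) ≠ 0 ∧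
      (μHE[k] : Measure (EuclideanSpace ℝ (Fin (k + 1)))) (euclideanSimplex (k + 1)) ≠ ∞ by
    have : IsProbabilityMeasure (cond (μHE[k + 1 - 1] : Measure (EuclideanSpace ℝ (Fin (k + 1))))
        (euclideanSimplex (k + 1))) := cond_isProbabilityMeasure_of_finite h.1 h.2
    exact Measure.isProbabilityMeasure_map (by fun_prop)
  have hvol : (μH[(k : ℝ)] : Measure (Fin k → ℝ)) = volume := by
    simpa using hausdorffMeasure_pi_real (ι := Fin k)
  rw [Measure.euclideanHausdorffMeasure_def, Measure.smul_apply, ENNReal.smul_def, smul_eq_mul]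
  refine ⟨mul_ne_zero ?_ ?_, ENNReal.mul_ne_top ENNReal.coe_ne_top ?_⟩
  · simpa using Measure.addHaarScalarFactor_volume_hausdorffMeasure_ne_zero k
  · let π : EuclideanSpace ℝ (Fin (k + 1)) → (Fin k → ℝ) := fun x i => x i.succ
    have hπ : LipschitzWith 1 π := by
      refine LipschitzWith.of_dist_le_mul fun x y => ?_
      rw [NNReal.coe_one, one_mul, dist_pi_le_iff dist_nonneg]
      exact fun i => PiLp.dist_apply_le x y i.succ
    let U : Set (Fin k → ℝ) := {y | (∀ i, 0 < y i) ∧ ∑ i, y i < 1}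
    have hU : IsOpen U := by
      refine IsOpen.inter (s := {y : Fin k → ℝ | ∀ i, 0 < y i})
        (t := {y : Fin k → ℝ | ∑ i, y i < 1}) ?_ (isOpen_lt (by fun_prop) continuous_const)
      rw [Set.ofPred_forall]
      exact isOpen_iInter_of_finite fun i => isOpen_lt continuous_const (continuous_apply i)
    have hne : U.Nonempty := by
      refine ⟨fun _ => 1 / ((k : ℝ) + 1), fun i => by positivity, ?_⟩
      simp only [Finset.sum_const, Finset.card_univ, Fintype.card_fin, nsmul_eq_mul]
      rw [mul_one_div, div_lt_one (by positivity)]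
      linarith
    have hsub : U ⊆ π '' euclideanSimplex (k + 1) := by
      intro y hy
      refine ⟨WithLp.toLp 2 (Fin.cons (1 - ∑ i, y i) y), ⟨?_, ?_⟩, ?_⟩
      · intro i
        refine Fin.cases ?_ (fun j => ?_) i
        · simpa using hy.2.le
        · simpa using (hy.1 j).le
      · simp [Fin.sum_univ_succ]
      · ext i
        simp [π]
    intro h0
    have h1 := hπ.hausdorffMeasure_image_le (d := (k : ℝ)) (by positivity)
      (euclideanSimplex (k + 1))
    rw [h0, mul_zero, hvol] at h1
    exact (hU.measure_pos volume hne).ne' (le_antisymm ((measure_mono hsub).trans h1) zero_le)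
  · let L : (Fin k → ℝ) →ₗ[ℝ] EuclideanSpace ℝ (Fin (k + 1)) :=
      { toFun := fun y => WithLp.toLp 2 (Fin.cons (-∑ i, y i) y)
        map_add' := fun x y => by
          ext i
          refine Fin.cases ?_ (fun j => ?_) i
          · simp [Finset.sum_add_distrib, add_comm]
          · simp
        map_smul' := fun c y => by
          ext i
          refine Fin.cases ?_ (fun j => ?_) i
          · simp [Finset.mul_sum]
          · simp }
    let φ : (Fin k → ℝ) → EuclideanSpace ℝ (Fin (k + 1)) :=
      fun y => EuclideanSpace.single 0 1 + LinearMap.toContinuousLinearMap L y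
    have hφ : LipschitzWith ‖LinearMap.toContinuousLinearMap L‖₊ φ := by
      refine LipschitzWith.of_dist_le_mul fun x y => ?_
      simp only [φ, dist_add_left]
      exact (LinearMap.toContinuousLinearMap L).lipschitz.dist_le_mul x y
    have hsub : euclideanSimplex (k + 1) ⊆ φ '' Set.Icc 0 1 := by
      intro x hx
      have hsum := hx.2
      rw [Fin.sum_univ_succ] at hsum
      refine ⟨fun i => x i.succ, ⟨fun i => hx.1 _, fun i => ?_⟩, ?_⟩
      · have := Finset.single_le_sum (fun j _ => hx.1 j) (Finset.mem_univ i.succ)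
        rw [hx.2] at this
        exact this
      · ext i
        refine Fin.cases ?_ (fun j => ?_) i
        · simp [φ, L]
          linarith
        · simp [φ, L]
    refine ne_top_of_le_ne_top ?_ ((measure_mono hsub).trans
      (hφ.hausdorffMeasure_image_le (d := (k : ℝ)) (by positivity) _))
    rw [hvol]
    refine ENNReal.mul_ne_top (by simp) ?_
    exact (isCompact_Icc.measure_lt_top).ne

/-- The lower bound `0.25 log log n - C`, logarithms to base 2 (`0` when this is negative). -/
noncomputable def quarterLogLog (n : ℕ) (C : ℝ) : ℝ≥0∞ :=
  ENNReal.ofReal (0.25 * Real.logb 2 (Real.logb 2 n) - C)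

/-! Suppose that for some value `y` half of the law of `X` given `Y = y` sits on points of
conditional probability at most `M`. If `X = g(Y, E')` with `E'` independent of `Y`, that
conditional law is the law of `g(y, E')`, so half of the mass of `E'` sits on atoms of size at most
`M`, whence `H(E') ≥ log(1/M) / 2`. It remains to find such a `y` (`HasSpreadFiber`).

Since `H(E) ≤ c`, some noise value `k₀` has probability at least `κ = 2^(-c)`. In each of the three
cases a positive fraction of the `x` satisfies `s/n ≤ p x ≤ β/n`. On these points `f(·, k₀)` throws
order `n` balls into `n` bins, and with high probability some bin `y` receives at least `l = (log
n)^(3/4)` of them (`card_fiber_lt_le_exp`). These balls contribute at least `T/n` to `P(Y = y)`,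
where `T = l s κ`. The other values of `f` are independent of the choice of `y` and contribute `1/n`
at most on average, so by Markov they exceed `T/n` with probability at most `1/T`
(`card_forall_heavy_fiber_le`). Otherwise the balls in the bin carry at least half of `P(Y = y)`,
each with conditional probability at most `M = β/T`.

With `s = (log n)^(-1/4)` one gets `T = κ (log n)^(1/2)`, and `log(1/M) / 2` is `0.25 log log n`
minus a constant. No bound involves `m`. -/

/-! ### Entropy bounds from the size of atoms -/

theorem ofReal_neg_logb_mul_tsum_le_shannonEntropy {ι : Type*} (e : ι → ℝ) (he : ∀ i, 0 ≤ e i)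
    (J : Set ι) {M : ℝ} (h : ∀ i ∈ J, e i ≤ M) :
    ENNReal.ofReal (-Real.logb 2 M) * ∑' i, J.indicator (fun i => ENNReal.ofReal (e i)) i ≤
      shannonEntropy e := by
  unfold shannonEntropy
  rw [← ENNReal.tsum_mul_left]
  refine ENNReal.tsum_le_tsum fun i => ?_
  by_cases hi : i ∈ J
  · rw [Set.indicator_of_mem hi]
    rcases (he i).eq_or_lt with h0 | h0
    · simp [← h0]
    rw [← ENNReal.ofReal_mul' (he i)]
    refine ENNReal.ofReal_le_ofReal ?_
    have hl : Real.log (e i) ≤ Real.log M := Real.log_le_log h0 (h i hi)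
    have h2 : 0 < Real.log 2 := Real.log_pos (by norm_num)
    rw [Real.logb, Real.negMulLog, ← neg_div, div_mul_eq_mul_div]
    exact div_le_div_of_nonneg_right (by nlinarith) h2.le
  · simp [Set.indicator_of_notMem hi]

theorem IsSCM.measureReal_inter {Ω α β ι : Type*} [MeasurableSpace Ω] [MeasurableSpace α]
    [MeasurableSpace β] [MeasurableSpace ι] [DiscreteMeasurableSpace ι] [MeasurableSingletonClass α]
    {μ : Measure Ω} {A : Ω → α} {B : Ω → β} {E : Ω → ι} {g : α → ι → β}
    (h : IsSCM μ A B E g) (a : α) (b : β) :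
    μ.real (A ⁻¹' {a} ∩ B ⁻¹' {b}) = μ.real (A ⁻¹' {a}) * μ.real (E ⁻¹' {i | g a i = b}) := by
  have h1 : μ.real (A ⁻¹' {a} ∩ B ⁻¹' {b}) = μ.real (A ⁻¹' {a} ∩ E ⁻¹' {i | g a i = b}) := by
    refine measureReal_congr ?_
    filter_upwards [h.effect_eq] with ω hω
    refine propext ?_
    show (A ω = a ∧ B ω = b) ↔ (A ω = a ∧ g a (E ω) = b)
    constructor
    · rintro ⟨rfl, rfl⟩
      exact ⟨rfl, hω.symm⟩
    · rintro ⟨rfl, rfl⟩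
      exact ⟨rfl, hω⟩
  rw [h1, measureReal_def, h.indep.measure_inter_preimage_eq_mul _ _ (measurableSet_singleton a)
    (MeasurableSet.of_discrete), ENNReal.toReal_mul]
  rfl

/-- By independence `g a E` has the conditional law of `B` given `A = a`. An atom `i` of `E` with `g
a i ∈ S` is no heavier than the value `g a i`, hence at most `M`, and these atoms together carry
mass at least `1/2`. -/
theorem IsSCM.le_rvEntropy {Ω α β ι : Type*} [MeasurableSpace Ω] [MeasurableSpace α] [Fintype β]
    [MeasurableSpace β] [MeasurableSpace ι] [DiscreteMeasurableSpace ι] [MeasurableSingletonClass α]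
    [MeasurableSingletonClass β] [Countable ι]
    {μ : Measure Ω} [IsProbabilityMeasure μ] {A : Ω → α} {B : Ω → β} {E : Ω → ι} {g : α → ι → β}
    (h : IsSCM μ A B E g) (a : α) (S : Finset β) (w : β → ℝ) {M : ℝ}
    (hw : ∀ b, μ.real (A ⁻¹' {a} ∩ B ⁻¹' {b}) = w b) (hpos : 0 < ∑ b, w b)
    (hM : ∀ b ∈ S, w b ≤ M * ∑ b, w b) (hS : ∑ b, w b ≤ 2 * ∑ b ∈ S, w b) :
    ENNReal.ofReal (-Real.logb 2 M / 2) ≤ rvEntropy μ E := by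
  classical
  have htot : μ.real (A ⁻¹' {a}) = ∑ b, w b := by
    have hd : Pairwise (Function.onFun Disjoint fun b => A ⁻¹' {a} ∩ B ⁻¹' {b}) := by
      intro b c hbc
      refine Set.disjoint_left.2 ?_
      rintro ω ⟨-, h1⟩ ⟨-, h2⟩
      exact hbc (h1.symm.trans h2)
    have hu : A ⁻¹' {a} = ⋃ b, A ⁻¹' {a} ∩ B ⁻¹' {b} := by
      ext ω; simp
    rw [hu, measureReal_iUnion_fintype hd fun b =>
      (h.measurable_cause (measurableSet_singleton a)).inter
        (h.measurable_effect (measurableSet_singleton b))]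
    exact Finset.sum_congr rfl fun b _ => hw b
  have hr (b : β) : μ.real (E ⁻¹' {i | g a i = b}) * ∑ b, w b = w b := by
    rw [← hw b, h.measureReal_inter, htot, mul_comm]
  have hmono (i : ι) (hi : g a i ∈ S) : μ.real (E ⁻¹' {i}) ≤ M := by
    have h1 : μ.real (E ⁻¹' {i}) ≤ μ.real (E ⁻¹' {j | g a j = g a i}) :=
      measureReal_mono (Set.preimage_mono (by simp))
    refine h1.trans (le_of_mul_le_mul_right ?_ hpos)
    rw [hr]
    exact hM _ hi
  have hJ : ∑' i, {i | g a i ∈ S}.indicator (fun i => ENNReal.ofReal (μ.real (E ⁻¹' {i}))) i =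
      μ (E ⁻¹' {i | g a i ∈ S}) := by
    rw [← tsum_subtype, ← tsum_measure_preimage_singleton (Set.to_countable _)]
    · exact tsum_congr fun i => ofReal_measureReal
    · exact fun i _ => h.measurable_noise (measurableSet_singleton i)
  have hhalf : 1 / 2 ≤ μ.real (E ⁻¹' {i | g a i ∈ S}) := by
    have hu : E ⁻¹' {i | g a i ∈ S} = ⋃ b ∈ S, E ⁻¹' {i | g a i = b} := by
      ext ω; simp
    rw [hu, measureReal_biUnion_finset]
    · refine le_of_mul_le_mul_right ?_ hpos
      rw [Finset.sum_mul, Finset.sum_congr rfl fun b _ => hr b]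
      linarith
    · intro b _ c _ hbc
      refine Set.disjoint_left.2 fun ω h1 h2 => hbc ?_
      exact h1.symm.trans h2
    · exact fun b _ => h.measurable_noise MeasurableSet.of_discrete
  refine le_trans ?_ (ofReal_neg_logb_mul_tsum_le_shannonEntropy _ (fun i => measureReal_nonneg)
    {i | g a i ∈ S} hmono)
  rw [hJ, ← ofReal_measureReal, div_eq_mul_one_div, ENNReal.ofReal_mul' (by norm_num)]
  gcongr

/-- Shannon entropy dominates min-entropy; the witness is the largest atom. -/
theorem exists_rpow_neg_le_of_shannonEntropy_le {m : ℕ} {q : Fin m → ℝ} {c : ℝ≥0}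
    (hq : q ∈ stdSimplex ℝ (Fin m)) (hc : shannonEntropy q ≤ c) :
    ∃ k, (2 : ℝ) ^ (-(c : ℝ)) ≤ q k := by
  have hne : Nonempty (Fin m) := by
    by_contra hne
    rw [not_nonempty_iff] at hne
    simpa using hq.2
  obtain ⟨k, hk⟩ := Finite.exists_max q
  refine ⟨k, ?_⟩
  have hpos : 0 < q k := by
    by_contra h0
    have : ∑ i, q i ≤ 0 := Finset.sum_nonpos fun i _ => (hk i).trans (not_lt.1 h0)
    linarith [hq.2]
  have h1 := (ofReal_neg_logb_mul_tsum_le_shannonEntropy q hq.1 Set.univ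
    (M := q k) (fun i _ => hk i)).trans hc
  rw [Set.indicator_univ, tsum_fintype, ← ENNReal.ofReal_sum_of_nonneg fun i _ => hq.1 i, hq.2,
    ENNReal.ofReal_one, mul_one, ENNReal.ofReal_le_coe] at h1
  rw [← Real.le_logb_iff_rpow_le (by norm_num) hpos]
  linarith

/-! ### Joint law of the model and reverse models -/

/-- The probability of `X = x`, `Y = y` in the model `(p, q, f)`. -/
noncomputable def jointProb {n m : ℕ} (p : Fin n → ℝ) (q : Fin m → ℝ) (f : Fin n → Fin m → Fin n)
    (y x : Fin n) : ℝ :=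
  p x * ∑ k, if f x k = y then q k else 0

theorem RealizesModel.measureReal_inter {Ω : Type*} [MeasurableSpace Ω] {n m : ℕ} {μ : Measure Ω}
    [IsProbabilityMeasure μ] {X Y : Ω → Fin n} {E : Ω → Fin m} {p : Fin n → ℝ} {q : Fin m → ℝ}
    {f : Fin n → Fin m → Fin n} (h : RealizesModel μ X Y E p q f) (x y : Fin n) :
    μ.real (Y ⁻¹' {y} ∩ X ⁻¹' {x}) = jointProb p q f y x := by
  rw [Set.inter_comm, h.scm.measureReal_inter, h.law_cause, jointProb]
  congr 1
  have hu : E ⁻¹' {k | f x k = y} = ⋃ k ∈ Finset.univ.filter (fun k => f x k = y), E ⁻¹' {k} := by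
    ext ω; simp
  rw [hu, measureReal_biUnion_finset, Finset.sum_filter]
  · exact Finset.sum_congr rfl fun k _ => by rw [h.law_noise]
  · intro b _ c _ hbc
    refine Set.disjoint_left.2 fun ω h1 h2 => hbc ?_
    exact h1.symm.trans h2
  · exact fun b _ => h.scm.measurable_noise MeasurableSet.of_discrete

/-- Every structural causal model from `Y` to `X` whose joint law is that of the model `(p, q, f)`
has exogenous entropy at least `b`. -/
def LawEntropyGE {n m : ℕ} (p : Fin n → ℝ) (q : Fin m → ℝ) (f : Fin n → Fin m → Fin n)
    (b : ℝ≥0∞) : Prop :=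
  ∀ (Ω : Type) [MeasurableSpace Ω] (μ : Measure Ω) [IsProbabilityMeasure μ]
    (ι : Type) [Countable ι] [MeasurableSpace ι] [DiscreteMeasurableSpace ι]
    (A B : Ω → Fin n) (E' : Ω → ι) (g : Fin n → ι → Fin n), IsSCM μ A B E' g →
    (∀ x y, μ.real (A ⁻¹' {y} ∩ B ⁻¹' {x}) = jointProb p q f y x) → b ≤ rvEntropy μ E'

theorem LawEntropyGE.reverseEntropyGE {n m : ℕ} {p : Fin n → ℝ} {q : Fin m → ℝ}
    {f : Fin n → Fin m → Fin n} {b : ℝ≥0∞} (h : LawEntropyGE p q f b) :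
    ReverseEntropyGE p q f b := by
  intro Ω _ μ _ X Y E hm ι _ _ _ E' g hs
  exact h Ω μ ι Y X E' g hs hm.measureReal_inter

/-- The given model itself bounds the forward infimum. Competitors for the reverse infimum live on
other probability spaces and share only the joint law, which is all that `LawEntropyGE` asks for. -/
theorem LawEntropyGE.modelIdentifiable {n m : ℕ} {p : Fin n → ℝ} {q : Fin m → ℝ}
    {f : Fin n → Fin m → Fin n} {b c : ℝ≥0∞} (h : LawEntropyGE p q f b) (hbc : c < b)
    (hq : shannonEntropy q ≤ c) : ModelIdentifiable p q f c := by
  intro Ω _ μ _ X Y E hm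
  have hX := hm.scm.measurable_cause
  have hY := hm.scm.measurable_effect
  refine ⟨?_, hbc.trans_le ?_⟩
  · have hmin : minExogenousEntropy (μ.map fun ω => (X ω, Y ω)) ≤ rvEntropy μ E :=
      sInf_le ⟨Ω, inferInstance, μ, inferInstance, Fin m, inferInstance, inferInstance,
        inferInstance, X, Y, E, f, hm.scm, rfl, rfl⟩
    refine hmin.trans ?_
    rw [rvEntropy, funext hm.law_noise]
    exact hq
  · refine le_sInf ?_
    rintro _ ⟨Ω', _, μ', _, ι, _, _, _, A, B, E', g, hs, hlaw, rfl⟩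
    refine h Ω' μ' ι A B E' g hs ?_
    intro x y
    have hA := hs.measurable_cause
    have hB := hs.measurable_effect
    rw [← hm.measureReal_inter]
    rw [Measure.map_map measurable_swap (hX.prodMk hY)] at hlaw
    have h1 := congrArg (fun ν => ν.real {(y, x)}) hlaw
    beta_reduce at h1
    rw [map_measureReal_apply (hA.prodMk hB) (measurableSet_singleton _),
      map_measureReal_apply (measurable_swap.comp (hX.prodMk hY)) (measurableSet_singleton _)] at h1
    convert h1 using 2 <;>
    · ext ω
      simp

/-! ### Balls in bins: the maximal load of a random map -/

/-- With `N = card α`, the count is `N!` times the coefficient of `z ^ N` in the `n`-th power of the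
truncated exponential series, and a coefficient times `z ^ N` is at most the value at `z`. The
induction removes the fibre over `0`, so `α` must vary. -/
theorem card_fiber_lt_mul_pow_le (L : ℕ) {z : ℝ} (hz : 0 ≤ z) (n : ℕ) :
    ∀ (α : Type) [Fintype α] [DecidableEq α],
      ((Finset.univ.filter fun h : α → Fin n =>
        ∀ y, (Finset.univ.filter fun a => h a = y).card < L).card : ℝ) * z ^ Fintype.card α ≤
      (Fintype.card α).factorial * (∑ j ∈ Finset.range L, z ^ j / j.factorial) ^ n := by
  have hE : 0 ≤ ∑ j ∈ Finset.range L, z ^ j / (j.factorial : ℝ) :=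
    Finset.sum_nonneg fun j _ => by positivity
  induction n with
  | zero =>
    intro α _ _
    rcases isEmpty_or_nonempty α with hα | ⟨⟨a⟩⟩
    · simp
    · have : IsEmpty (α → Fin 0) := ⟨fun h => (h a).elim0⟩
      simp
  | succ n ih =>
    intro α _ _
    set E := ∑ j ∈ Finset.range L, z ^ j / (j.factorial : ℝ) with hEdef
    set N := Fintype.card α with hN
    set good : (β : Type) → [Fintype β] → [DecidableEq β] → (k : ℕ) → Finset (β → Fin k) :=
      fun β _ _ k => Finset.univ.filter fun h : β → Fin k =>
        ∀ y, (Finset.univ.filter fun a => h a = y).card < L with hgood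
    -- Once the fibre `T` over `0` is fixed, the map is determined by its restriction to the
    -- complement of `T`, with values lowered by one.
    have hfib (T : Finset α) :
        (((good α (n + 1)).filter fun h => (Finset.univ.filter fun a => h a = 0) = T).card : ℝ)
          * z ^ N ≤ if T.card < L then ((N - T.card).factorial : ℝ) * z ^ T.card * E ^ n else 0 := by
      split_ifs with hT
      · have hcard : Fintype.card {a // a ∉ T} = N - T.card := by
          rw [Fintype.card_subtype_compl, Fintype.card_coe]
        have hTN : T.card ≤ N := Finset.card_le_univ T
        have hle : ((good α (n + 1)).filter fun h =>
            (Finset.univ.filter fun a => h a = 0) = T).card ≤ (good {a // a ∉ T} n).card := by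
          let ext : ({a // a ∉ T} → Fin n) → α → Fin (n + 1) :=
            fun h a => if ha : a ∈ T then 0 else (h ⟨a, ha⟩).succ
          refine (Finset.card_le_card (t := (good {a // a ∉ T} n).image ext) ?_).trans
            Finset.card_image_le
          intro h hh
          rw [Finset.mem_filter] at hh
          obtain ⟨hg, hT0⟩ := hh
          have hmem (a : α) : a ∈ T ↔ h a = 0 := by rw [← hT0]; simp
          have hne (a : {a // a ∉ T}) : h a ≠ 0 := fun h0 => a.2 ((hmem a).2 h0)
          refine Finset.mem_image.2 ⟨fun a => (h a).pred (hne a), ?_, ?_⟩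
          · simp only [hgood, Finset.mem_filter, Finset.mem_univ, true_and] at hg ⊢
            intro y
            refine lt_of_le_of_lt (Finset.card_le_card_of_injOn Subtype.val ?_
              Subtype.val_injective.injOn) (hg y.succ)
            intro a ha
            simp only [Finset.coe_filter, Finset.mem_univ, true_and, Set.mem_ofPred_eq] at ha ⊢
            rw [← ha, Fin.succ_pred]
          · funext a
            by_cases ha : a ∈ T
            · simp [ext, ha, (hmem a).1 ha]
            · simp [ext, ha]
        have h1 := ih {a // a ∉ T}
        rw [hcard] at h1
        calc _ ≤ ((good {a // a ∉ T} n).card : ℝ) * z ^ N := by gcongr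
          _ = ((good {a // a ∉ T} n).card : ℝ) * z ^ (N - T.card) * z ^ T.card := by
            rw [mul_assoc, ← pow_add, Nat.sub_add_cancel hTN]
          _ ≤ ((N - T.card).factorial : ℝ) * E ^ n * z ^ T.card := by gcongr
          _ = _ := by ring
      · rw [Finset.card_eq_zero.2, Nat.cast_zero, zero_mul]
        rw [Finset.filter_eq_empty_iff]
        rintro h hh rfl
        simp only [hgood, Finset.mem_filter, Finset.mem_univ, true_and] at hh
        exact hT (hh 0)
    have hsum : (good α (n + 1)).card = ∑ T ∈ (Finset.univ : Finset α).powerset,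
        ((good α (n + 1)).filter fun h => (Finset.univ.filter fun a => h a = 0) = T).card :=
      Finset.card_eq_sum_card_fiberwise fun h _ => by simp
    change ((good α (n + 1)).card : ℝ) * z ^ N ≤ _
    rw [hsum, Nat.cast_sum, Finset.sum_mul]
    refine (Finset.sum_le_sum fun T _ => hfib T).trans ?_
    -- The bound depends on `T` only through its size `j`, and `N.choose j * (N - j)! = N! / j!`
    -- produces the series coefficients.
    rw [Finset.sum_powerset_apply_card
      (fun j => if j < L then ((N - j).factorial : ℝ) * z ^ j * E ^ n else 0), Finset.card_univ,
      ← hN, pow_succ', Finset.sum_mul, Finset.mul_sum]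
    have hterm (j : ℕ) (hj : j ∈ Finset.range (N + 1)) :
        N.choose j • (if j < L then ((N - j).factorial : ℝ) * z ^ j * E ^ n else 0) =
          if j < L then (N.factorial : ℝ) * (z ^ j / j.factorial * E ^ n) else 0 := by
      split_ifs
      · have h2 : ((N.choose j * j.factorial * (N - j).factorial : ℕ) : ℝ) = N.factorial := by
          rw [Nat.choose_mul_factorial_mul_factorial (by simpa [Nat.lt_succ_iff] using hj)]
        push_cast at h2
        rw [← h2, nsmul_eq_mul]
        field_simp
      · simp
    rw [Finset.sum_congr rfl hterm, ← Finset.sum_filter]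
    refine Finset.sum_le_sum_of_subset_of_nonneg ?_ fun j _ _ => by positivity
    intro j hj
    simpa using (Finset.mem_filter.1 hj).2

/-- Stirling's upper bound up to a polynomial factor; the induction step is `e ≤ (1 + 1/N) ^ (N +
1)`. -/
theorem factorial_mul_exp_le {N : ℕ} (hN : 0 < N) :
    (N.factorial : ℝ) * Real.exp N ≤ Real.exp 1 * N * N ^ N := by
  induction N, hN using Nat.le_induction with
  | base => simp
  | succ N hN ih =>
    have hN' : (0 : ℝ) < N := by exact_mod_cast hN
    have hlog : 1 ≤ ((N : ℝ) + 1) * Real.log (1 + 1 / N) := by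
      have h1 := Real.one_sub_inv_le_log_of_pos (x := 1 + 1 / (N : ℝ)) (by positivity)
      have h2 : 1 - (1 + 1 / (N : ℝ))⁻¹ = 1 / ((N : ℝ) + 1) := by field_simp; ring
      rw [h2] at h1
      rwa [div_le_iff₀' (by positivity)] at h1
    have hexp : Real.exp 1 ≤ (1 + 1 / (N : ℝ)) ^ (N + 1) := by
      rw [← Real.exp_log (by positivity : (0 : ℝ) < (1 + 1 / (N : ℝ)) ^ (N + 1)), Real.log_pow]
      exact Real.exp_le_exp.2 (by push_cast; exact hlog)
    have hpow : Real.exp 1 * (N : ℝ) ^ (N + 1) ≤ ((N : ℝ) + 1) ^ (N + 1) := by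
      calc _ ≤ (1 + 1 / (N : ℝ)) ^ (N + 1) * (N : ℝ) ^ (N + 1) := by gcongr
        _ = _ := by rw [← mul_pow]; congr 1; field_simp
    rw [Nat.factorial_succ]
    push_cast
    rw [Real.exp_add]
    calc ((N : ℝ) + 1) * N.factorial * (Real.exp N * Real.exp 1)
        = ((N : ℝ) + 1) * Real.exp 1 * (N.factorial * Real.exp N) := by ring
      _ ≤ ((N : ℝ) + 1) * Real.exp 1 * (Real.exp 1 * N * N ^ N) := by gcongr
      _ = ((N : ℝ) + 1) * Real.exp 1 * (Real.exp 1 * N ^ (N + 1)) := by ring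
      _ ≤ ((N : ℝ) + 1) * Real.exp 1 * ((N : ℝ) + 1) ^ (N + 1) := by gcongr
      _ = _ := by ring

/-- Take `z = N / n` in the generating function bound: then `exp z ^ n = exp N` cancels against `N!`
by Stirling. The truncated series misses at least the term `z ^ L / L! ≥ (γ / L) ^ L`, a relative
loss of at least `t` because `z ≤ 1`, and this gains `exp (-t)` in each of the `n` factors. -/
theorem card_fiber_lt_le_exp {α : Type} [Fintype α] [DecidableEq α] {n : ℕ} (L : ℕ) {γ : ℝ}
    (hγ : 0 < γ) (hn : 0 < n) (h1 : γ * n ≤ Fintype.card α) (h2 : Fintype.card α ≤ n) :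
    ((Finset.univ.filter fun h : α → Fin n =>
        ∀ y, (Finset.univ.filter fun a => h a = y).card < L).card : ℝ) ≤
      (n : ℝ) ^ Fintype.card α *
        (Real.exp 1 * n * Real.exp (-(n * Real.exp (-1) * (γ / L) ^ L))) := by
  set N := Fintype.card α with hN
  have hn' : (0 : ℝ) < n := by exact_mod_cast hn
  have hN0 : (0 : ℝ) < N := lt_of_lt_of_le (by positivity) h1
  have h2' : (N : ℝ) ≤ n := by exact_mod_cast h2
  set z : ℝ := N / n with hz
  have hz0 : 0 < z := by positivity
  have hz1 : z ≤ 1 := (div_le_one hn').2 h2'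
  have hγz : γ ≤ z := (le_div_iff₀ hn').2 h1
  have hcount := card_fiber_lt_mul_pow_le L hz0.le n α
  rw [← hN] at hcount
  set E := ∑ j ∈ Finset.range L, z ^ j / (j.factorial : ℝ) with hE
  have hE0 : 0 ≤ E := Finset.sum_nonneg fun j _ => by positivity
  set t := Real.exp (-1) * (γ / L) ^ L with ht
  have hEle : E ≤ Real.exp z * Real.exp (-t) := by
    have h3 := Real.sum_le_exp_of_nonneg hz0.le (L + 1)
    rw [Finset.sum_range_succ] at h3
    have h4 : (γ / L) ^ L ≤ z ^ L / L.factorial := by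
      rw [div_pow]
      have : (L.factorial : ℝ) ≤ (L : ℝ) ^ L := by exact_mod_cast Nat.factorial_le_pow L
      gcongr
    have h5 : t * Real.exp z ≤ z ^ L / L.factorial := by
      calc t * Real.exp z = (γ / L) ^ L * (Real.exp (-1) * Real.exp z) := by rw [ht]; ring
        _ ≤ (γ / L) ^ L * 1 := by
          rw [← Real.exp_add]
          gcongr
          exact Real.exp_le_one_iff.2 (by linarith)
        _ ≤ _ := by rw [mul_one]; exact h4
    have h6 := Real.add_one_le_exp (-t)
    nlinarith [Real.exp_pos z]
  have hEn : E ^ n ≤ Real.exp N * Real.exp (-(n * t)) := by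
    calc E ^ n ≤ (Real.exp z * Real.exp (-t)) ^ n := by gcongr
      _ = _ := by
        rw [mul_pow, ← Real.exp_nat_mul, ← Real.exp_nat_mul, hz]
        congr 2
        · field_simp
        · ring
  have hfac := factorial_mul_exp_le (N := N) (by exact_mod_cast hN0)
  set a : ℝ := ((Finset.univ.filter fun h : α → Fin n =>
        ∀ y, (Finset.univ.filter fun a => h a = y).card < L).card : ℝ)
  have key : a * z ^ N ≤ Real.exp 1 * n * N ^ N * Real.exp (-(n * t)) := by
    calc a * z ^ N ≤ N.factorial * E ^ n := hcount
      _ ≤ N.factorial * (Real.exp N * Real.exp (-(n * t))) := by gcongr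
      _ = N.factorial * Real.exp N * Real.exp (-(n * t)) := by ring
      _ ≤ Real.exp 1 * N * N ^ N * Real.exp (-(n * t)) := by gcongr
      _ ≤ _ := by gcongr
  rw [hz, div_pow] at key
  have hNN : (0 : ℝ) < (N : ℝ) ^ N := by positivity
  refine le_of_mul_le_mul_right ?_ hNN
  calc a * (N : ℝ) ^ N = a * ((N : ℝ) ^ N / (n : ℝ) ^ N) * (n : ℝ) ^ N := by field_simp
    _ ≤ Real.exp 1 * n * N ^ N * Real.exp (-(n * t)) * (n : ℝ) ^ N := by gcongr
    _ = _ := by rw [ht]; ring_nf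

theorem card_filter_apply_eq_mul {ι : Type*} [Fintype ι] [DecidableEq ι] {n : ℕ} (i : ι)
    (y : Fin n) : ((Finset.univ.filter fun r : ι → Fin n => r i = y).card : ℝ) * n =
      (n : ℝ) ^ Fintype.card ι := by
  have h := Fintype.card_filter_piFinset_const_eq_of_mem (Finset.univ : Finset (Fin n)) i
    (Finset.mem_univ y)
  rw [Fintype.piFinset_univ, Finset.card_univ, Fintype.card_fin] at h
  rw [h]
  push_cast
  rw [← pow_succ, Nat.sub_add_cancel (Fintype.card_pos_iff.2 ⟨i⟩)]

/-- Either no fibre inside `D` reaches size `L`, which costs `K`, or a bin `y` chosen from `F` on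
`D` does. The values off `D` are independent of that choice, so their weight in `y` has mean at most
`1 / n`, and Markov's inequality costs `1 / T`. -/
theorem card_forall_heavy_fiber_le {I : Type} [Fintype I] [DecidableEq I] {n L : ℕ} (hn : 0 < n)
    (D : Finset I) (w : I → ℝ) (hw : ∀ i, 0 ≤ w i) (hw1 : ∑ i, w i ≤ 1) {T K : ℝ} (hT : 0 < T)
    (hK : ((Finset.univ.filter fun h : {i // i ∈ D} → Fin n =>
        ∀ y, (Finset.univ.filter fun a => h a = y).card < L).card : ℝ) ≤
        (n : ℝ) ^ Fintype.card {i // i ∈ D} * K) :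
    ((Finset.univ.filter fun F : I → Fin n => ∀ y, L ≤ (D.filter fun i => F i = y).card →
        T / n < ∑ i ∈ Dᶜ, if F i = y then w i else 0).card : ℝ) ≤
      (n : ℝ) ^ Fintype.card I * (K + 1 / T) := by
  classical
  have hn' : (0 : ℝ) < n := by exact_mod_cast hn
  let low (h : {i // i ∈ D} → Fin n) : Prop :=
    ∀ y, (Finset.univ.filter fun a => h a = y).card < L
  -- The chosen bin must be a function of the restriction to `D` alone; where no bin is heavy it is
  -- arbitrary.
  have hex (h : {i // i ∈ D} → Fin n) :
      ∃ y, ¬ low h → L ≤ (Finset.univ.filter fun a => h a = y).card := by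
    by_cases hl : low h
    · exact ⟨⟨0, hn⟩, fun h' => absurd hl h'⟩
    · simp only [low, not_forall, not_lt] at hl
      exact hl.imp fun y hy _ => hy
  choose y hy using hex
  let e := Equiv.piEquivPiSubtypeProd (fun i => i ∈ D) (fun _ => Fin n)
  have hpt (F : I → Fin n) :
      (if (∀ y, L ≤ (D.filter fun i => F i = y).card →
        T / n < ∑ i ∈ Dᶜ, if F i = y then w i else 0) then (1 : ℝ) else 0) ≤
      (if low (e F).1 then 1 else 0) +
        n / T * ∑ i : {i // i ∉ D}, if (e F).2 i = y (e F).1 then w i else 0 := by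
    have hR : 0 ≤ ∑ i : {i // i ∉ D}, if (e F).2 i = y (e F).1 then w i else 0 :=
      Finset.sum_nonneg fun i _ => by split_ifs <;> simp [hw]
    have hR' : 0 ≤ n / T * ∑ i : {i // i ∉ D}, if (e F).2 i = y (e F).1 then w i else 0 := by
      positivity
    by_cases hlow : low (e F).1
    · rw [if_pos hlow]
      split_ifs <;> linarith
    · rw [if_neg hlow, zero_add]
      split_ifs with hbad
      · have h1 := hbad (y (e F).1) ?_
        · rw [Finset.sum_subtype Dᶜ (p := fun i => i ∉ D) (fun i => Finset.mem_compl)] at h1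
          rw [div_mul_eq_mul_div, one_le_div hT]
          rw [div_lt_iff₀' hn'] at h1
          exact h1.le
        · refine (hy _ hlow).trans (Finset.card_le_card_of_injOn Subtype.val ?_
            Subtype.val_injective.injOn)
          intro a ha
          simp only [Finset.coe_filter, Finset.mem_univ, true_and, Set.mem_ofPred_eq] at ha ⊢
          exact ⟨a.2, ha⟩
      · exact hR'
  have hcardI : (n : ℝ) ^ Fintype.card I =
      (n : ℝ) ^ Fintype.card {i // i ∈ D} * (n : ℝ) ^ Fintype.card {i // i ∉ D} := by
    rw [← pow_add, Fintype.card_subtype_compl, Nat.add_sub_cancel' (Fintype.card_subtype_le _)]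
  rw [Finset.natCast_card_filter]
  refine (Finset.sum_le_sum fun F _ => hpt F).trans ?_
  rw [Fintype.sum_equiv e _ (fun x => (if low x.1 then 1 else 0) +
        n / T * ∑ i : {i // i ∉ D}, if x.2 i = y x.1 then w i else 0) fun F => rfl,
    Fintype.sum_prod_type]
  have hrest (h : {i // i ∈ D} → Fin n) : ∑ r : {i // i ∉ D} → Fin n,
      (n / T * ∑ i : {i // i ∉ D}, if r i = y h then w i else 0) ≤
        (n : ℝ) ^ Fintype.card {i // i ∉ D} * (1 / T) := by
    rw [← Finset.mul_sum, Finset.sum_comm]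
    have h1 (i : {i // i ∉ D}) : (∑ r : {i // i ∉ D} → Fin n, if r i = y h then w i else 0) * n =
        (n : ℝ) ^ Fintype.card {i // i ∉ D} * w i := by
      rw [← card_filter_apply_eq_mul i (y h), ← Finset.sum_filter, Finset.sum_const, nsmul_eq_mul]
      ring
    calc _ = 1 / T * ∑ i : {i // i ∉ D},
          ((∑ r : {i // i ∉ D} → Fin n, if r i = y h then w i else 0) * n) := by
          rw [← Finset.sum_mul]; ring
      _ = (n : ℝ) ^ Fintype.card {i // i ∉ D} * (1 / T) * ∑ i : {i // i ∉ D}, w i := by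
          rw [Finset.sum_congr rfl fun i _ => h1 i, ← Finset.mul_sum]; ring
      _ ≤ (n : ℝ) ^ Fintype.card {i // i ∉ D} * (1 / T) * 1 := by
          gcongr
          rw [← Finset.sum_subtype Dᶜ (p := fun i => i ∉ D) (fun i => Finset.mem_compl) w]
          exact (Finset.sum_le_sum_of_subset_of_nonneg (Finset.subset_univ _)
            fun i _ _ => hw i).trans hw1
      _ = _ := mul_one _
  simp_rw [Finset.sum_add_distrib]
  rw [mul_add, hcardI]
  refine add_le_add ?_ ?_
  · change (∑ h : {i // i ∈ D} → Fin n, ∑ _r : {i // i ∉ D} → Fin n,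
      if low h then (1 : ℝ) else 0) ≤ _
    simp_rw [Finset.sum_const]
    rw [← Finset.smul_sum, Finset.card_univ, Fintype.card_fun, Fintype.card_fin, nsmul_eq_mul,
      ← Finset.natCast_card_filter]
    push_cast
    calc _ ≤ (n : ℝ) ^ Fintype.card {i // i ∉ D} * ((n : ℝ) ^ Fintype.card {i // i ∈ D} * K) := by
          gcongr
      _ = _ := by ring
  · refine (Finset.sum_le_sum fun h _ => hrest h).trans ?_
    rw [Finset.sum_const, Finset.card_univ, Fintype.card_fun, Fintype.card_fin, nsmul_eq_mul]
    push_cast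
    exact le_of_eq (by ring)

/-! ### Coordinates of a uniform point of the simplex -/

/-- The homothety of ratio `1 - t` centred at the `i`-th vertex maps the simplex into its part with
`t ≤ p i` and scales `(n - 1)`-dimensional measure by `(1 - t) ^ (n - 1)`. -/
theorem one_sub_pow_le_uniformSimplex {n : ℕ} (hn : 0 < n) (i : Fin n) {t : ℝ} (h0 : 0 ≤ t)
    (h1 : t < 1) : ENNReal.ofReal ((1 - t) ^ (n - 1)) ≤ uniformSimplex n {p | t ≤ p i} := by
  have hprob := isProbabilityMeasure_uniformSimplex hn
  set μ : Measure (EuclideanSpace ℝ (Fin n)) := μHE[n - 1] with hμ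
  have hclosed : IsClosed (euclideanSimplex n) :=
    (isClosed_stdSimplex ℝ (Fin n)).preimage (by fun_prop)
  have hme : Measurable (WithLp.ofLp : EuclideanSpace ℝ (Fin n) → Fin n → ℝ) := by fun_prop
  have hA : MeasurableSet {p : Fin n → ℝ | t ≤ p i} :=
    measurableSet_le measurable_const (measurable_pi_apply i)
  -- Conditioning on a set of measure `0` or `∞` would give the zero measure, not a probability
  -- measure.
  have hne : μ (euclideanSimplex n) ≠ 0 ∧ μ (euclideanSimplex n) ≠ ∞ := by
    have hu := hprob.measure_univ
    rw [uniformSimplex, Measure.map_apply hme MeasurableSet.univ, Set.preimage_univ,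
      cond_apply hclosed.measurableSet, Set.inter_univ, ← hμ] at hu
    constructor
    · intro h
      simp [h] at hu
    · intro h
      simp [h] at hu
  rw [uniformSimplex, Measure.map_apply hme hA, cond_apply hclosed.measurableSet, ← hμ]
  have hsub : AffineMap.homothety (EuclideanSpace.single i (1 : ℝ)) (1 - t) '' euclideanSimplex n ⊆
      euclideanSimplex n ∩ WithLp.ofLp ⁻¹' {p : Fin n → ℝ | t ≤ p i} := by
    rintro _ ⟨x, ⟨hx0, hx1⟩, rfl⟩
    have hval (j : Fin n) : (AffineMap.homothety (EuclideanSpace.single i (1 : ℝ)) (1 - t) x).ofLp j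
        = (1 - t) * x j + t * (if j = i then 1 else 0) := by
      simp only [AffineMap.homothety_apply, vsub_eq_sub, vadd_eq_add, PiLp.add_apply,
        PiLp.smul_apply, PiLp.sub_apply, PiLp.single_apply, smul_eq_mul]
      split_ifs <;> ring
    refine ⟨⟨fun j => ?_, ?_⟩, ?_⟩
    · rw [hval]
      have := hx0 j
      have h2 : 0 ≤ 1 - t := by linarith
      split_ifs <;> positivity
    · simp_rw [hval]
      rw [Finset.sum_add_distrib, ← Finset.mul_sum, ← Finset.mul_sum, hx1]
      simp
    · show t ≤ _
      rw [hval, if_pos rfl]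
      have := mul_nonneg (by linarith : 0 ≤ 1 - t) (hx0 i)
      linarith
  have hvol : ENNReal.ofReal ((1 - t) ^ (n - 1)) * μ (euclideanSimplex n) ≤
      μ (euclideanSimplex n ∩ WithLp.ofLp ⁻¹' {p : Fin n → ℝ | t ≤ p i}) := by
    refine le_trans (le_of_eq ?_) (measure_mono hsub)
    rw [hμ, euclideanHausdorffMeasure_homothety_image _ _ (by linarith : (1 - t) ≠ 0),
      ENNReal.smul_def, smul_eq_mul]
    congr 1
    rw [← ENNReal.ofReal_coe_nnreal]
    congr 1
    push_cast
    rw [Real.norm_of_nonneg (by linarith)]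
  calc _ = (μ (euclideanSimplex n))⁻¹ *
        (ENNReal.ofReal ((1 - t) ^ (n - 1)) * μ (euclideanSimplex n)) := by
        rw [mul_left_comm, ENNReal.inv_mul_cancel hne.1 hne.2, mul_one]
    _ ≤ _ := by gcongr

theorem uniformSimplex_apply_lt_le {n : ℕ} (hn : 0 < n) (i : Fin n) {t : ℝ} (h0 : 0 ≤ t)
    (h1 : t < 1) : uniformSimplex n {p | p i < t} ≤ ENNReal.ofReal (n * t) := by
  have hprob := isProbabilityMeasure_uniformSimplex hn
  have hA : MeasurableSet {p : Fin n → ℝ | t ≤ p i} :=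
    measurableSet_le measurable_const (measurable_pi_apply i)
  have hc : {p : Fin n → ℝ | p i < t} = {p : Fin n → ℝ | t ≤ p i}ᶜ := by
    ext p; simp
  rw [hc, prob_compl_eq_one_sub hA]
  refine (tsub_le_tsub_left (one_sub_pow_le_uniformSimplex hn i h0 h1) 1).trans ?_
  rw [← ENNReal.ofReal_one, ← ENNReal.ofReal_sub _ (by
    have : 0 ≤ 1 - t := by linarith
    positivity)]
  refine ENNReal.ofReal_le_ofReal ?_
  have hb := one_add_mul_le_pow (a := -t) (by linarith) (n - 1)
  have hcast : ((n - 1 : ℕ) : ℝ) ≤ n := by exact_mod_cast Nat.sub_le n 1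
  rw [← sub_eq_add_neg] at hb
  nlinarith

theorem ae_mem_stdSimplex_uniformSimplex (n : ℕ) :
    ∀ᵐ p ∂uniformSimplex n, p ∈ stdSimplex ℝ (Fin n) := by
  have hclosed : IsClosed (euclideanSimplex n) :=
    (isClosed_stdSimplex ℝ (Fin n)).preimage (by fun_prop)
  exact (ae_map_iff (p := fun p => p ∈ stdSimplex ℝ (Fin n)) (by fun_prop)
    (isClosed_stdSimplex ℝ (Fin n)).measurableSet).2 (ae_cond_mem hclosed.measurableSet)

/-- The number of `x` with `t / n ≤ p x ≤ β / n`. -/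
noncomputable def balancedSupport {n : ℕ} (p : Fin n → ℝ) (t β : ℝ) : Finset (Fin n) :=
  Finset.univ.filter fun x => t / n ≤ p x ∧ p x ≤ β / n

/-- At most `n / 4` coordinates exceed `4 / n`, since they sum to `1`. So fewer than `n / 2`
balanced coordinates force at least `n / 4` below `t / n`, whereas their expected number is at most
`t * n`; Markov's inequality gives `4 * t`. -/
theorem uniformSimplex_balancedSupport_lt_le {n : ℕ} (hn : 2 ≤ n) {t : ℝ} (h0 : 0 < t)
    (h1 : t ≤ 1) :
    uniformSimplex n {p | ((balancedSupport p t 4).card : ℝ) < 1 / 2 * n} ≤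
      ENNReal.ofReal (4 * t) := by
  have hn0 : (0 : ℝ) < n := by positivity
  let F : (Fin n → ℝ) → ℝ≥0∞ := fun p => ∑ i, {p : Fin n → ℝ | p i < t / n}.indicator 1 p
  have hms (i : Fin n) : MeasurableSet {p : Fin n → ℝ | p i < t / n} :=
    measurableSet_lt (measurable_pi_apply i) measurable_const
  have hF : Measurable F :=
    Finset.measurable_sum _ fun i _ => measurable_one.indicator (hms i)
  have hint : ∫⁻ p, F p ∂uniformSimplex n ≤ ENNReal.ofReal (n * t) := by
    rw [lintegral_finsetSum _ fun i _ => measurable_one.indicator (hms i)]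
    calc _ ≤ ∑ _i : Fin n, ENNReal.ofReal (n * (t / n)) := by
          refine Finset.sum_le_sum fun i _ => ?_
          rw [lintegral_indicator_one (hms i)]
          refine uniformSimplex_apply_lt_le (by omega) i (by positivity) ?_
          rw [div_lt_one hn0]
          have : (2 : ℝ) ≤ n := by exact_mod_cast hn
          linarith
      _ = _ := by
          rw [Finset.sum_const, Finset.card_univ, Fintype.card_fin, nsmul_eq_mul,
            mul_div_cancel₀ _ hn0.ne', ENNReal.ofReal_mul hn0.le, ENNReal.ofReal_natCast]
  have hsub : ∀ᵐ p ∂uniformSimplex n, ((balancedSupport p t 4).card : ℝ) < 1 / 2 * n →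
      ENNReal.ofReal (n / 4) ≤ F p := by
    filter_upwards [ae_mem_stdSimplex_uniformSimplex n] with p hp hcard
    have hFp : F p = ((Finset.univ.filter fun i => p i < t / n).card : ℝ≥0∞) := by
      rw [Finset.natCast_card_filter]
      rfl
    rw [hFp, ← ENNReal.ofReal_natCast]
    refine ENNReal.ofReal_le_ofReal ?_
    have hbig : ((Finset.univ.filter fun i => 4 / (n : ℝ) < p i).card : ℝ) ≤ n / 4 := by
      have h2 : ((Finset.univ.filter fun i => 4 / (n : ℝ) < p i).card : ℝ) * (4 / n) ≤ 1 := by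
        rw [← hp.2, ← nsmul_eq_mul]
        refine (Finset.card_nsmul_le_sum _ p _ fun i hi => (Finset.mem_filter.1 hi).2.le).trans ?_
        exact Finset.sum_le_sum_of_subset_of_nonneg (Finset.filter_subset _ _) fun i _ _ => hp.1 i
      rw [← mul_div_assoc, div_le_one hn0] at h2
      linarith
    have hcover : (n : ℝ) ≤ (balancedSupport p t 4).card +
        (Finset.univ.filter fun i => p i < t / n).card +
        (Finset.univ.filter fun i => 4 / (n : ℝ) < p i).card := by
      have : n ≤ (balancedSupport p t 4 ∪ (Finset.univ.filter fun i => p i < t / n) ∪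
          (Finset.univ.filter fun i => 4 / (n : ℝ) < p i)).card := by
        rw [Finset.eq_univ_of_forall (s := _ ∪ _), Finset.card_univ, Fintype.card_fin]
        intro i
        simp only [balancedSupport, Finset.mem_union, Finset.mem_filter, Finset.mem_univ, true_and]
        by_cases h3 : p i < t / n
        · exact Or.inl (Or.inr h3)
        · by_cases h4 : 4 / (n : ℝ) < p i
          · exact Or.inr h4
          · exact Or.inl (Or.inl ⟨not_lt.1 h3, not_lt.1 h4⟩)
      have h5 := this.trans ((Finset.card_union_le _ _).trans
        (Nat.add_le_add_right (Finset.card_union_le _ _) _))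
      exact_mod_cast h5
    linarith
  have hpos : ENNReal.ofReal (n / 4) ≠ 0 := by
    rw [ne_eq, ENNReal.ofReal_eq_zero, not_le]; positivity
  refine (measure_mono_ae hsub).trans ((meas_ge_le_lintegral_div hF.aemeasurable hpos
    ENNReal.ofReal_ne_top).trans ((ENNReal.div_le_div_right hint _).trans ?_))
  rw [← ENNReal.ofReal_div_of_pos (by positivity)]
  refine ENNReal.ofReal_le_ofReal (le_of_eq ?_)
  field_simp

/-! ### Balanced points from large entropy -/

/-- The relative entropy `∑ p log (n p)` to the uniform law is bounded, so the points above `β / n`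
carry mass at most `1/4`. The points below `t / n` also carry at most `1/4`. The remaining mass
`1/2` consists of atoms of size at most `β / n`, so there are at least `n / (2 β)` of them. -/
theorem le_card_balancedSupport_of_shannonEntropy {n : ℕ} {a t : ℝ} {p : Fin n → ℝ}
    (hp : p ∈ stdSimplex ℝ (Fin n)) (ha : ENNReal.ofReal (Real.logb 2 n - a) ≤ shannonEntropy p)
    (ht : t ≤ 1 / 4) :
    1 / (2 * Real.exp (4 * (max a 0 + 1))) * n ≤
      ((balancedSupport p t (Real.exp (4 * (max a 0 + 1)))).card : ℝ) := by
  rcases Nat.eq_zero_or_pos n with rfl | hn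
  · simp
  have hn0 : (0 : ℝ) < n := by exact_mod_cast hn
  have hl2 : 0 < Real.log 2 := Real.log_pos (by norm_num)
  have hl2' : Real.log 2 ≤ 1 := by linarith [Real.log_two_lt_d9]
  set a' := max a 0 with ha'
  have ha0 : 0 ≤ a' := le_max_right _ _
  set β := Real.exp (4 * (a' + 1)) with hβ
  have hp1 (i : Fin n) : p i ≤ 1 := by
    rw [← hp.2]
    exact Finset.single_le_sum (fun j _ => hp.1 j) (Finset.mem_univ i)
  have hent (i : Fin n) : 0 ≤ Real.negMulLog (p i) / Real.log 2 :=
    div_nonneg (Real.negMulLog_nonneg (hp.1 i) (hp1 i)) hl2.le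
  rw [shannonEntropy, tsum_fintype, ← ENNReal.ofReal_sum_of_nonneg fun i _ => hent i,
    ENNReal.ofReal_le_ofReal_iff (Finset.sum_nonneg fun i _ => hent i), ← Finset.sum_div,
    le_div_iff₀ hl2, Real.logb, sub_mul, div_mul_cancel₀ _ hl2.ne'] at ha
  have hKL : ∑ i, p i * Real.log (n * p i) ≤ a' := by
    have h1 : ∑ i, p i * Real.log (n * p i) = Real.log n - ∑ i, Real.negMulLog (p i) := by
      have h2 (i : Fin n) : p i * Real.log (n * p i) = p i * Real.log n - Real.negMulLog (p i) := by
        rcases (hp.1 i).eq_or_lt with h | h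
        · simp [← h]
        · rw [Real.log_mul hn0.ne' h.ne', Real.negMulLog]; ring
      rw [Finset.sum_congr rfl fun i _ => h2 i, Finset.sum_sub_distrib, ← Finset.sum_mul, hp.2,
        one_mul]
    have h3 : a * Real.log 2 ≤ a' * 1 :=
      (mul_le_mul_of_nonneg_right (le_max_left a 0) hl2.le).trans (by gcongr)
    rw [h1]
    linarith
  -- From `log u ≥ 1 - 1/u`. The negative terms cost at most `1` in total, hence the `+ 1` in the
  -- exponent of `β`; the factor `4` there yields the mass `1/4`.
  have hlow (i : Fin n) : -(1 / (n : ℝ)) ≤ p i * Real.log (n * p i) := by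
    rcases (hp.1 i).eq_or_lt with h | h
    · rw [← h]
      simp
    · have h4 := Real.one_sub_inv_le_log_of_pos (x := n * p i) (by positivity)
      calc -(1 / (n : ℝ)) ≤ p i * (1 - (n * p i)⁻¹) := by
            rw [mul_sub, mul_one, mul_inv, mul_left_comm, mul_inv_cancel₀ h.ne', mul_one,
              one_div]
            linarith
        _ ≤ _ := by gcongr
  set Bg := Finset.univ.filter fun i => β / (n : ℝ) < p i with hBg
  have hbig : ∑ i ∈ Bg, p i ≤ 1 / 4 := by
    have h5 (i : Fin n) : (if i ∈ Bg then p i * (4 * (a' + 1)) else 0) - 1 / (n : ℝ) ≤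
        p i * Real.log (n * p i) := by
      split_ifs with hi
      · have h6 : β < n * p i := by
          rw [← div_lt_iff₀' hn0]
          exact (Finset.mem_filter.1 hi).2
        have h7 : 4 * (a' + 1) ≤ Real.log (n * p i) := by
          rw [← Real.log_exp (4 * (a' + 1))]
          exact Real.log_le_log (Real.exp_pos _) h6.le
        have h8 : 0 ≤ 1 / (n : ℝ) := by positivity
        have h9 := mul_le_mul_of_nonneg_left h7 (hp.1 i)
        linarith
      · linarith [hlow i]
    have h10 := (Finset.sum_le_sum fun i (_ : i ∈ Finset.univ) => h5 i).trans hKL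
    rw [Finset.sum_sub_distrib, Finset.sum_const, Finset.card_univ, Fintype.card_fin,
      nsmul_eq_mul, mul_one_div_cancel hn0.ne', Finset.sum_ite_mem, Finset.univ_inter,
      ← Finset.sum_mul] at h10
    have h11 : (∑ i ∈ Bg, p i) * (4 * (a' + 1)) ≤ 1 / 4 * (4 * (a' + 1)) := by linarith
    exact le_of_mul_le_mul_right h11 (by positivity)
  have hsmall : ∑ i ∈ Finset.univ.filter (fun i => p i < t / (n : ℝ)), p i ≤ 1 / 4 := by
    have h12 : (0 : ℝ) ≤ 1 / 4 / n := by positivity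
    calc _ ≤ ∑ i ∈ Finset.univ.filter (fun i => p i < t / (n : ℝ)), 1 / 4 / (n : ℝ) := by
          refine Finset.sum_le_sum fun i hi => (Finset.mem_filter.1 hi).2.le.trans ?_
          gcongr
      _ ≤ ∑ _i : Fin n, 1 / 4 / (n : ℝ) :=
          Finset.sum_le_sum_of_subset_of_nonneg (Finset.filter_subset _ _) fun _ _ _ => h12
      _ = 1 / 4 := by
          rw [Finset.sum_const, Finset.card_univ, Fintype.card_fin, nsmul_eq_mul]
          field_simp
  have hcover : 1 ≤ ∑ i ∈ balancedSupport p t β, p i +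
      ∑ i ∈ Finset.univ.filter (fun i => p i < t / (n : ℝ)), p i + ∑ i ∈ Bg, p i := by
    rw [← hp.2, balancedSupport, hBg, Finset.sum_filter, Finset.sum_filter, Finset.sum_filter,
      ← Finset.sum_add_distrib, ← Finset.sum_add_distrib]
    refine Finset.sum_le_sum fun i _ => ?_
    have := hp.1 i
    by_cases h3 : p i < t / n
    · rw [if_pos h3]
      split_ifs <;> linarith
    · by_cases h4 : β / (n : ℝ) < p i
      · rw [if_pos h4]
        split_ifs <;> linarith
      · rw [if_pos ⟨not_lt.1 h3, not_lt.1 h4⟩]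
        split_ifs; linarith
  have hG : ∑ i ∈ balancedSupport p t β, p i ≤ (balancedSupport p t β).card * (β / n) := by
    rw [← nsmul_eq_mul]
    exact Finset.sum_le_card_nsmul _ _ _ fun i hi => (Finset.mem_filter.1 hi).2.2
  have hfin : 1 / 2 ≤ (balancedSupport p t β).card * (β / n) := by linarith
  have hβ0 : 0 < β := Real.exp_pos _
  calc 1 / (2 * β) * n = 1 / 2 * (n / β) := by field_simp
    _ ≤ (balancedSupport p t β).card * (β / n) * (n / β) := by gcongr
    _ = _ := by field_simp

/-- Summing `p i ≤ ρ * p j` over `j` gives `p i ≤ ρ / n`, and the entropy is at least the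
min-entropy. -/
theorem ofReal_logb_sub_le_shannonEntropy {n : ℕ} {ρ : ℝ} {p : Fin n → ℝ}
    (hp : p ∈ stdSimplex ℝ (Fin n)) (hρ : ∀ i j, p i ≤ ρ * p j) :
    ENNReal.ofReal (Real.logb 2 n - Real.logb 2 ρ) ≤ shannonEntropy p := by
  have hn : 0 < n := by
    rcases Nat.eq_zero_or_pos n with rfl | hn
    · simpa using hp.2
    · exact hn
  have hn0 : (0 : ℝ) < n := by exact_mod_cast hn
  have hM (i : Fin n) : p i ≤ ρ / n := by
    have h := Finset.sum_le_sum fun j (_ : j ∈ Finset.univ) => hρ i j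
    rw [← Finset.mul_sum, hp.2, Finset.sum_const, Finset.card_univ, Fintype.card_fin,
      nsmul_eq_mul, mul_one] at h
    rwa [le_div_iff₀' hn0]
  have hρ0 : 0 < ρ := by
    by_contra h
    have h1 : ρ / n ≤ 0 := div_nonpos_of_nonpos_of_nonneg (not_lt.1 h) hn0.le
    have h2 := Finset.sum_nonpos fun i (_ : i ∈ Finset.univ) => (hM i).trans h1
    rw [hp.2] at h2
    linarith
  have h := ofReal_neg_logb_mul_tsum_le_shannonEntropy p hp.1 Set.univ fun i _ => hM i
  rwa [Set.indicator_univ, tsum_fintype, ← ENNReal.ofReal_sum_of_nonneg fun i _ => hp.1 i, hp.2,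
    ENNReal.ofReal_one, mul_one, Real.logb_div hρ0.ne' hn0.ne', neg_sub] at h

/-! ### Existence of a spread fibre -/

/-- Some value `y` of `Y` has a set `S` of preimages carrying at least half of the conditional law
of `X` given `Y = y`, each of conditional probability at most `M`. -/
def HasSpreadFiber {n m : ℕ} (p : Fin n → ℝ) (q : Fin m → ℝ) (f : Fin n → Fin m → Fin n)
    (M : ℝ) : Prop :=
  ∃ (y : Fin n) (S : Finset (Fin n)), 0 < ∑ x, jointProb p q f y x ∧
    (∀ x ∈ S, jointProb p q f y x ≤ M * ∑ x, jointProb p q f y x) ∧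
    ∑ x, jointProb p q f y x ≤ 2 * ∑ x ∈ S, jointProb p q f y x

theorem HasSpreadFiber.lawEntropyGE {n m : ℕ} {p : Fin n → ℝ} {q : Fin m → ℝ}
    {f : Fin n → Fin m → Fin n} {M : ℝ} (h : HasSpreadFiber p q f M) :
    LawEntropyGE p q f (ENNReal.ofReal (-Real.logb 2 M / 2)) := by
  obtain ⟨y, S, hpos, hM, hS⟩ := h
  intro Ω _ μ _ ι _ _ _ A B E' g hs hlaw
  exact hs.le_rvEntropy y S (jointProb p q f y) (fun x => hlaw x y) hpos hM hS

theorem measurableSet_hasSpreadFiber {n m : ℕ} (q : Fin m → ℝ) (f : Fin n → Fin m → Fin n)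
    (M : ℝ) : MeasurableSet {p : Fin n → ℝ | HasSpreadFiber p q f M} := by
  have hJ (y x : Fin n) : Measurable fun p : Fin n → ℝ => jointProb p q f y x :=
    (measurable_pi_apply x).mul_const _
  have hT (y : Fin n) (S : Finset (Fin n)) :
      Measurable fun p : Fin n → ℝ => ∑ x ∈ S, jointProb p q f y x :=
    Finset.measurable_sum _ fun x _ => hJ y x
  have hset : {p : Fin n → ℝ | HasSpreadFiber p q f M} = ⋃ (y : Fin n) (S : Finset (Fin n)),
      {p : Fin n → ℝ | 0 < ∑ x, jointProb p q f y x} ∩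
        ((⋂ x ∈ S, {p : Fin n → ℝ | jointProb p q f y x ≤ M * ∑ x, jointProb p q f y x}) ∩
          {p : Fin n → ℝ | ∑ x, jointProb p q f y x ≤ 2 * ∑ x ∈ S, jointProb p q f y x}) := by
    ext p
    simp [HasSpreadFiber]
  rw [hset]
  refine MeasurableSet.iUnion fun y => MeasurableSet.iUnion fun S => ?_
  refine (measurableSet_lt measurable_const (hT y _)).inter (MeasurableSet.inter ?_ ?_)
  · exact MeasurableSet.iInter fun x => MeasurableSet.iInter fun _ =>
      measurableSet_le (hJ y x) ((hT y _).const_mul _)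
  · exact measurableSet_le (hT y _) ((hT y _).const_mul _)

theorem jointProb_eq_sum {n m : ℕ} (p : Fin n → ℝ) (q : Fin m → ℝ) (f : Fin n → Fin m → Fin n)
    (y x : Fin n) : jointProb p q f y x = ∑ k, if f x k = y then p x * q k else 0 := by
  rw [jointProb, Finset.mul_sum]
  exact Finset.sum_congr rfl fun k _ => by rw [mul_ite, mul_zero]

/-- The balanced `x` with `f x k₀ = y` contribute at least `l * (s / n) * κ` to the mass of `y`,
which dominates the remainder bounded by `hR`. Each such `x` has joint probability at most `p x ≤ β
/ n`. -/
theorem hasSpreadFiber_of_card_le {n m : ℕ} {p : Fin n → ℝ} {q : Fin m → ℝ}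
    (hn : 0 < n) (hp : p ∈ stdSimplex ℝ (Fin n)) (hq : q ∈ stdSimplex ℝ (Fin m)) {k₀ : Fin m}
    {κ s β l : ℝ} (hκ : 0 < κ) (hs : 0 < s) (hβ : 0 < β) (hl : 0 < l) (hk : κ ≤ q k₀)
    (f : Fin n → Fin m → Fin n) (y : Fin n)
    (hL : l ≤ ((balancedSupport p s β).filter fun x => f x k₀ = y).card)
    (hR : ∑ i ∈ (balancedSupport p s β ×ˢ {k₀})ᶜ,
      (if f i.1 i.2 = y then p i.1 * q i.2 else 0) ≤ l * s * κ / n) :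
    HasSpreadFiber p q f (β / (l * s * κ)) := by
  have hn0 : (0 : ℝ) < n := by exact_mod_cast hn
  set S := (balancedSupport p s β).filter fun x => f x k₀ = y with hS
  set T := l * s * κ with hT
  have hT0 : 0 < T := by positivity
  have htot : ∑ x, jointProb p q f y x =
      ∑ i : Fin n × Fin m, if f i.1 i.2 = y then p i.1 * q i.2 else 0 := by
    rw [Fintype.sum_prod_type]
    exact Finset.sum_congr rfl fun x _ => jointProb_eq_sum p q f y x
  have hmain : ∑ i ∈ balancedSupport p s β ×ˢ {k₀},
      (if f i.1 i.2 = y then p i.1 * q i.2 else 0) = ∑ x ∈ S, p x * q k₀ := by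
    rw [Finset.sum_product, hS, Finset.sum_filter]
    exact Finset.sum_congr rfl fun x _ => by rw [Finset.sum_singleton]
  have hsplit := Finset.sum_add_sum_compl (balancedSupport p s β ×ˢ {k₀})
    fun i : Fin n × Fin m => if f i.1 i.2 = y then p i.1 * q i.2 else 0
  rw [hmain, ← htot] at hsplit
  have hlower : T / n ≤ ∑ x ∈ S, p x * q k₀ := by
    have h1 : ∀ x ∈ S, s / n * κ ≤ p x * q k₀ := by
      intro x hx
      have h2 := (Finset.mem_filter.1 (Finset.mem_filter.1 hx).1).2.1
      have := hp.1 x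
      gcongr
    have h3 := Finset.card_nsmul_le_sum S _ _ h1
    rw [nsmul_eq_mul] at h3
    refine le_trans ?_ h3
    calc T / n = l * (s / n * κ) := by rw [hT]; ring
      _ ≤ _ := by gcongr
  have hle : ∑ x ∈ S, p x * q k₀ ≤ ∑ x ∈ S, jointProb p q f y x := by
    refine Finset.sum_le_sum fun x hx => ?_
    rw [jointProb_eq_sum]
    refine le_trans (le_of_eq ?_) (Finset.single_le_sum (f := fun k =>
      if f x k = y then p x * q k else 0) (fun k _ => ?_) (Finset.mem_univ k₀))
    · rw [if_pos (Finset.mem_filter.1 hx).2]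
    · have := mul_nonneg (hp.1 x) (hq.1 k)
      split_ifs <;> simp [this]
  have hrest : 0 ≤ ∑ i ∈ (balancedSupport p s β ×ˢ {k₀})ᶜ,
      (if f i.1 i.2 = y then p i.1 * q i.2 else 0) :=
    Finset.sum_nonneg fun i _ => by
      have := mul_nonneg (hp.1 i.1) (hq.1 i.2)
      split_ifs <;> simp [this]
  have hTn : 0 < T / n := by positivity
  refine ⟨y, S, by linarith, fun x hx => ?_, by linarith⟩
  have h4 : jointProb p q f y x ≤ β / n := by
    refine le_trans ?_ (Finset.mem_filter.1 (Finset.mem_filter.1 hx).1).2.2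
    rw [jointProb]
    refine mul_le_of_le_one_right (hp.1 x) ?_
    rw [← hq.2]
    refine Finset.sum_le_sum fun k _ => ?_
    have := hq.1 k
    split_ifs <;> simp [this]
  refine h4.trans ?_
  calc β / n = β / T * (T / n) := by field_simp
    _ ≤ _ := by
      gcongr
      linarith

/-- The balls are the cells of `D = G × {k₀}`, and all cells `(x, k)` carry the weights `p x * q k`,
of total `1`. A map without spread fibre is bad at every heavy bin. -/
theorem uniformMap_not_hasSpreadFiber_le {n m : ℕ} {p : Fin n → ℝ} {q : Fin m → ℝ} (hn : 0 < n)
    (hp : p ∈ stdSimplex ℝ (Fin n)) (hq : q ∈ stdSimplex ℝ (Fin m)) {κ s β l γ : ℝ} (hκ : 0 < κ)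
    (hs : 0 < s) (hβ : 0 < β) (hl : 0 < l) (hγ : 0 < γ) (hk : ∃ k, κ ≤ q k)
    (hG : γ * n ≤ (balancedSupport p s β).card) :
    uniformMap n m {f | ¬ HasSpreadFiber p q f (β / (l * s * κ))} ≤
      ENNReal.ofReal (Real.exp 1 * n * Real.exp (-(n * Real.exp (-1) * (γ / ⌈l⌉₊) ^ ⌈l⌉₊)) +
        1 / (l * s * κ)) := by
  classical
  obtain ⟨k₀, hk⟩ := hk
  have hn0 : (0 : ℝ) < n := by exact_mod_cast hn
  set G := balancedSupport p s β with hGdef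
  set T := l * s * κ with hT
  have hT0 : 0 < T := by positivity
  set K := Real.exp 1 * n * Real.exp (-(n * Real.exp (-1) * (γ / ⌈l⌉₊) ^ ⌈l⌉₊)) with hK
  have hcardD : Fintype.card {i // i ∈ G ×ˢ ({k₀} : Finset (Fin m))} = G.card := by
    rw [Fintype.card_coe, Finset.card_product, Finset.card_singleton, mul_one]
  have hcount := card_forall_heavy_fiber_le (L := ⌈l⌉₊) hn (G ×ˢ ({k₀} : Finset (Fin m)))
    (fun i => p i.1 * q i.2) (fun i => mul_nonneg (hp.1 _) (hq.1 _))
    (by rw [Fintype.sum_prod_type]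
        simp_rw [← Finset.mul_sum, hq.2, mul_one, hp.2]
        exact le_rfl)
    hT0 (card_fiber_lt_le_exp ⌈l⌉₊ hγ hn (by rw [hcardD]; exact hG)
      (by rw [hcardD]; exact (Finset.card_le_univ G).trans (Fintype.card_fin n).le))
  rw [← hK] at hcount
  set bad := Finset.univ.filter fun f : Fin n → Fin m → Fin n => ¬ HasSpreadFiber p q f (β / T)
    with hbad
  have hle : (bad.card : ℝ) ≤ (n : ℝ) ^ Fintype.card (Fin n × Fin m) * (K + 1 / T) := by
    refine le_trans ?_ hcount
    have hinj : Set.InjOn (fun (f : Fin n → Fin m → Fin n) (i : Fin n × Fin m) => f i.1 i.2) bad :=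
      fun f _ g _ hfg => funext fun x => funext fun k => congrFun hfg (x, k)
    refine Nat.cast_le.2 (Finset.card_le_card_of_injOn _ ?_ hinj)
    intro f hf
    simp only [hbad, Finset.coe_filter, Finset.mem_univ, true_and, Set.mem_ofPred_eq] at hf ⊢
    intro y hy
    by_contra hR
    refine hf (hasSpreadFiber_of_card_le hn hp hq hκ hs hβ hl hk f y ?_ (not_lt.1 hR))
    refine (Nat.ceil_le.1 hy).trans (Nat.cast_le.2 ?_)
    refine Finset.card_le_card_of_injOn Prod.fst ?_ ?_
    · intro i hi
      simp only [Finset.coe_filter, Finset.mem_product, Finset.mem_singleton,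
        Set.mem_ofPred_eq] at hi ⊢
      refine ⟨hi.1.1, ?_⟩
      rw [← hi.1.2]
      exact hi.2
    · intro i hi j hj hij
      simp only [Finset.coe_filter, Finset.mem_product, Finset.mem_singleton,
        Set.mem_ofPred_eq] at hi hj
      exact Prod.ext hij (hi.1.2.trans hj.1.2.symm)
  have hset : {f | ¬ HasSpreadFiber p q f (β / T)} = (bad : Set (Fin n → Fin m → Fin n)) := by
    ext f; simp [hbad]
  rw [uniformMap, uniformOn_univ, hset, Measure.count_apply_finset, Fintype.card_fun,
    Fintype.card_fun, Fintype.card_fin, Fintype.card_fin]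
  refine ENNReal.div_le_of_le_mul ?_
  rw [← ENNReal.ofReal_natCast, ← ENNReal.ofReal_natCast ((n ^ m) ^ n), ← ENNReal.ofReal_mul' (by
    positivity)]
  refine ENNReal.ofReal_le_ofReal (hle.trans (le_of_eq ?_))
  rw [Fintype.card_prod, Fintype.card_fin, Fintype.card_fin, mul_comm n m, pow_mul, mul_comm]
  push_cast
  rfl

/-! ### Choice of parameters and asymptotics -/

/-- The bound on the probability that no fibre is spread out. -/
noncomputable def failureBound (γ c : ℝ) (n : ℕ) : ℝ :=
  Real.exp 1 * n * Real.exp (-(n * Real.exp (-1) *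
    (γ / ⌈Real.logb 2 n ^ (3 / 4 : ℝ)⌉₊) ^ ⌈Real.logb 2 n ^ (3 / 4 : ℝ)⌉₊)) +
    1 / (Real.logb 2 n ^ (1 / 2 : ℝ) * 2 ^ (-c))

theorem tendsto_logb_two_natCast : Tendsto (fun n : ℕ => Real.logb 2 n) atTop atTop :=
  (Real.tendsto_logb_atTop (by norm_num)).comp tendsto_natCast_atTop_atTop

/-- For `L` of order `(log n)^(3/4)`, `L * log (L / γ)` has order `(log n)^(3/4) log log n`, which
is `o(log n)`. Any load exponent below `1` would serve. -/
theorem eventually_ceil_pow_le {γ : ℝ} (hγ : 0 < γ) :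
    ∀ᶠ n : ℕ in atTop, (n : ℝ) ^ (-(1 / 2) : ℝ) ≤
      (γ / ⌈Real.logb 2 n ^ (3 / 4 : ℝ)⌉₊) ^ ⌈Real.logb 2 n ^ (3 / 4 : ℝ)⌉₊ := by
  have hl2 : 0 < Real.log 2 := Real.log_pos (by norm_num)
  have hsmall : ∀ᶠ x : ℝ in atTop, Real.log (2 / γ) + 3 / 4 * Real.log x ≤
      Real.log 2 / 4 * x ^ (1 / 4 : ℝ) := by
    have h1 : (fun x : ℝ => Real.log (2 / γ) + 3 / 4 * Real.log x) =o[atTop]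
        fun x : ℝ => x ^ (1 / 4 : ℝ) := by
      refine Asymptotics.IsLittleO.add ?_ ?_
      · exact (Asymptotics.isLittleO_const_left).2 (Or.inr
          (tendsto_norm_atTop_atTop.comp (tendsto_rpow_atTop (by norm_num))))
      · exact (isLittleO_log_rpow_atTop (by norm_num)).const_mul_left _
    filter_upwards [h1.bound (show 0 < Real.log 2 / 4 by positivity), eventually_ge_atTop 0]
      with x hx hx0
    rw [Real.norm_of_nonneg (by positivity : 0 ≤ x ^ (1 / 4 : ℝ))] at hx
    exact (le_abs_self _).trans hx
  filter_upwards [tendsto_logb_two_natCast.eventually hsmall,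
    tendsto_logb_two_natCast.eventually (eventually_ge_atTop 1),
    tendsto_logb_two_natCast.eventually (eventually_ge_atTop (γ ^ (4 / 3 : ℝ))),
    eventually_gt_atTop 0] with n hx h1 hxγ hn
  have hn0 : (0 : ℝ) < n := by exact_mod_cast hn
  set x := Real.logb 2 n with hxdef
  have hx0 : 0 < x := by linarith
  set l := x ^ (3 / 4 : ℝ) with hl
  have hl1 : 1 ≤ l := Real.one_le_rpow h1 (by norm_num)
  set L := ⌈l⌉₊ with hL
  have hLl : l ≤ L := Nat.le_ceil l
  have hL0 : (0 : ℝ) < L := by linarith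
  have hL2 : (L : ℝ) ≤ 2 * l := by
    have := Nat.ceil_lt_add_one (by linarith : 0 ≤ l)
    linarith
  have hγl : γ ≤ l := by
    have := Real.rpow_le_rpow (by positivity) hxγ (by norm_num : (0 : ℝ) ≤ 3 / 4)
    rw [← Real.rpow_mul hγ.le] at this
    norm_num at this
    exact this
  have hlogn : Real.log n = x * Real.log 2 := by
    rw [hxdef, Real.logb, div_mul_cancel₀ _ hl2.ne']
  have hlogL : Real.log (L / γ) ≤ Real.log (2 / γ) + 3 / 4 * Real.log x := by
    rw [← Real.log_rpow hx0, ← Real.log_mul (by positivity) (by positivity)]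
    refine Real.log_le_log (by positivity) ?_
    rw [div_mul_eq_mul_div]
    gcongr
  have hlogL0 : 0 ≤ Real.log (L / γ) := by
    refine Real.log_nonneg ?_
    rw [le_div_iff₀ hγ, one_mul]
    linarith
  have hkey : L * Real.log (L / γ) ≤ 1 / 2 * Real.log n := by
    calc L * Real.log (L / γ) ≤ 2 * l * (Real.log 2 / 4 * x ^ (1 / 4 : ℝ)) := by
          gcongr
          exact hlogL.trans hx
      _ = 1 / 2 * (l * x ^ (1 / 4 : ℝ) * Real.log 2) := by ring
      _ = _ := by
          rw [hl, ← Real.rpow_add hx0, hlogn]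
          norm_num
  rw [← Real.log_le_log_iff (by positivity) (by positivity), Real.log_rpow hn0, Real.log_pow,
    ← inv_div (L : ℝ) γ, Real.log_inv]
  linarith

theorem tendsto_failureBound {γ : ℝ} (hγ : 0 < γ) (c : ℝ) :
    Tendsto (failureBound γ c) atTop (𝓝 0) := by
  rw [← add_zero (0 : ℝ)]
  unfold failureBound
  refine Tendsto.add ?_ ?_
  · have hx : Tendsto (fun n : ℕ => Real.exp (-1) * (n : ℝ) ^ (1 / 2 : ℝ)) atTop atTop :=
      ((tendsto_rpow_atTop (by norm_num)).comp tendsto_natCast_atTop_atTop).const_mul_atTop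
        (Real.exp_pos _)
    -- With `u = e⁻¹ √n`, the first summand is eventually at most `e n exp(-u) = e³ u² exp(-u)`.
    have h1 := ((Real.tendsto_pow_mul_exp_neg_atTop_nhds_zero 2).comp hx).const_mul (Real.exp 3)
    rw [mul_zero] at h1
    refine squeeze_zero' (Eventually.of_forall fun n => by positivity) ?_ h1
    filter_upwards [eventually_ceil_pow_le hγ, eventually_gt_atTop 0] with n hle hn
    have hn0 : (0 : ℝ) < n := by exact_mod_cast hn
    have hsq : ((n : ℝ) ^ (1 / 2 : ℝ)) ^ 2 = n := by
      rw [← Real.rpow_natCast, ← Real.rpow_mul hn0.le]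
      norm_num
    have hcoef : Real.exp 3 * ((Real.exp (-1) * (n : ℝ) ^ (1 / 2 : ℝ)) ^ 2) = Real.exp 1 * n := by
      rw [mul_pow, hsq, ← mul_assoc, ← Real.exp_nat_mul, ← Real.exp_add]
      norm_num
    simp only [Function.comp_apply]
    rw [← mul_assoc, hcoef]
    refine mul_le_mul_of_nonneg_left (Real.exp_le_exp.2 (neg_le_neg ?_)) (by positivity)
    calc Real.exp (-1) * (n : ℝ) ^ (1 / 2 : ℝ)
        = n * Real.exp (-1) * (n : ℝ) ^ (-(1 / 2) : ℝ) := by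
          have h2 : (n : ℝ) * (n : ℝ) ^ (-(1 / 2) : ℝ) = (n : ℝ) ^ (1 / 2 : ℝ) := by
            nth_rewrite 1 [← Real.rpow_one (n : ℝ)]
            rw [← Real.rpow_add hn0]
            norm_num
          rw [← h2]
          ring
      _ ≤ _ := mul_le_mul_of_nonneg_left hle (by positivity)
  · simp_rw [one_div]
    refine Tendsto.inv_tendsto_atTop (Tendsto.atTop_mul_const (by positivity) ?_)
    exact (tendsto_rpow_atTop (by norm_num)).comp tendsto_logb_two_natCast

/-- The constant `C` in the bound `0.25 log log n - C`. -/
noncomputable def entropyLoss (β c : ℝ) : ℝ := (c + Real.logb 2 β) / 2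

theorem quarterLogLog_eq {n : ℕ} (hn : 2 ≤ n) {β c : ℝ} (hβ : 0 < β) :
    quarterLogLog n (entropyLoss β c) =
      ENNReal.ofReal (-Real.logb 2 (β / (Real.logb 2 n ^ (1 / 2 : ℝ) * 2 ^ (-c))) / 2) := by
  have hx : 0 < Real.logb 2 n := Real.logb_pos (by norm_num) (by exact_mod_cast hn)
  rw [quarterLogLog, entropyLoss, Real.logb_div hβ.ne' (by positivity),
    Real.logb_mul (by positivity) (by positivity), Real.logb_rpow_eq_mul_logb_of_pos hx,
    Real.logb_rpow (by norm_num) (by norm_num)]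
  congr 1
  ring

theorem exists_lt_quarterLogLog (c : ℝ≥0) (C : ℝ) :
    ∃ n₀ : ℕ, ∀ n, n₀ ≤ n → (c : ℝ≥0∞) < quarterLogLog n C := by
  have h : Tendsto (fun n : ℕ => 0.25 * Real.logb 2 (Real.logb 2 n)) atTop atTop :=
    ((Real.tendsto_logb_atTop (by norm_num)).comp tendsto_logb_two_natCast).const_mul_atTop
      (by norm_num)
  obtain ⟨n₀, hn₀⟩ := eventually_atTop.1 (h.eventually (eventually_gt_atTop ((c : ℝ) + C)))
  refine ⟨n₀, fun n hn => ?_⟩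
  rw [quarterLogLog, ← ENNReal.ofReal_coe_nnreal,
    ENNReal.ofReal_lt_ofReal_iff_of_nonneg c.coe_nonneg]
  linarith [hn₀ n hn]

/-- Here `κ = 2 ^ (-c)`, `s = (log n)^(-1/4)` and `l = (log n)^(3/4)`. The threshold `s` tends to
`0` because for a random `p` the failure probability includes `4 s`. -/
theorem uniformMap_not_hasSpreadFiber_le_failureBound {n m : ℕ} {p : Fin n → ℝ}
    {q : Fin m → ℝ} {c : ℝ≥0} (hn : 2 ≤ n) (hp : p ∈ stdSimplex ℝ (Fin n)) (hq : q ∈ stdSimplex ℝ (Fin m))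
    (hc : shannonEntropy q ≤ c) {β γ : ℝ} (hβ : 0 < β) (hγ : 0 < γ)
    (hG : γ * n ≤ (balancedSupport p (Real.logb 2 n ^ (-(1 / 4) : ℝ)) β).card) :
    uniformMap n m
        {f | ¬ HasSpreadFiber p q f (β / (Real.logb 2 n ^ (1 / 2 : ℝ) * 2 ^ (-(c : ℝ))))} ≤
      ENNReal.ofReal (failureBound γ c n) := by
  have hx : 0 < Real.logb 2 n := Real.logb_pos (by norm_num) (by exact_mod_cast hn)
  have h := uniformMap_not_hasSpreadFiber_le (by omega) hp hq (κ := 2 ^ (-(c : ℝ)))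
    (s := Real.logb 2 n ^ (-(1 / 4) : ℝ)) (l := Real.logb 2 n ^ (3 / 4 : ℝ)) (by positivity)
    (by positivity) hβ (by positivity) hγ (exists_rpow_neg_le_of_shannonEntropy_le hq hc) hG
  rw [← Real.rpow_add hx] at h
  norm_num at h
  rw [failureBound]
  norm_num
  exact h

theorem HasSpreadFiber.lawEntropyGE_quarterLogLog {n m : ℕ} {p : Fin n → ℝ} {q : Fin m → ℝ}
    {f : Fin n → Fin m → Fin n} {β c : ℝ} (hn : 2 ≤ n) (hβ : 0 < β)
    (h : HasSpreadFiber p q f (β / (Real.logb 2 n ^ (1 / 2 : ℝ) * 2 ^ (-c)))) :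
    LawEntropyGE p q f (quarterLogLog n (entropyLoss β c)) := by
  rw [quarterLogLog_eq hn hβ]
  exact h.lawEntropyGE

/-- The value `∞` below the threshold makes the probability bounds trivial for small `n`. -/
theorem tendsto_ite_le_ofReal {u : ℕ → ℝ} (hu : Tendsto u atTop (𝓝 0)) (N : ℕ) :
    Tendsto (fun n => if N ≤ n then ENNReal.ofReal (u n) else ∞) atTop (𝓝 0) := by
  have h := ENNReal.tendsto_ofReal hu
  rw [ENNReal.ofReal_zero] at h
  refine h.congr' ?_
  filter_upwards [eventually_ge_atTop N] with n hn
  rw [if_pos hn]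

theorem tendsto_logb_rpow_neg :
    Tendsto (fun n : ℕ => Real.logb 2 n ^ (-(1 / 4) : ℝ)) atTop (𝓝 0) :=
  (tendsto_rpow_neg_atTop (by norm_num)).comp tendsto_logb_two_natCast

/-! ### The three cases -/

theorem identifiable_of_shannonEntropy_ge (a : ℝ) (c : ℝ≥0) :
    ∃ (C : ℝ) (n₀ : ℕ) (δ : ℕ → ℝ≥0∞), Tendsto δ atTop (𝓝 0) ∧
      ∀ (n m : ℕ) (p : Fin n → ℝ) (q : Fin m → ℝ),
        p ∈ stdSimplex ℝ (Fin n) → ENNReal.ofReal (Real.logb 2 n - a) ≤ shannonEntropy p →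
        q ∈ stdSimplex ℝ (Fin m) → shannonEntropy q ≤ c →
        uniformMap n m {f | ¬ ReverseEntropyGE p q f (quarterLogLog n C)} ≤ δ n ∧
        (n₀ ≤ n → uniformMap n m {f | ¬ ModelIdentifiable p q f c} ≤ δ n) := by
  set β := Real.exp (4 * (max a 0 + 1)) with hβ
  have hβ0 : 0 < β := Real.exp_pos _
  obtain ⟨n₀, hn₀⟩ := exists_lt_quarterLogLog c (entropyLoss β c)
  obtain ⟨N, hN⟩ := eventually_atTop.1
    (tendsto_logb_rpow_neg.eventually_le_const (show (0 : ℝ) < 1 / 4 by norm_num))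
  refine ⟨entropyLoss β c, n₀, _, tendsto_ite_le_ofReal
    (tendsto_failureBound (γ := 1 / (2 * β)) (by positivity) c) (max N 2), ?_⟩
  intro n m p q hp hpa hq hc
  by_cases hn : max N 2 ≤ n
  · simp only [if_pos hn]
    have hn2 : 2 ≤ n := (le_max_right _ _).trans hn
    have h := uniformMap_not_hasSpreadFiber_le_failureBound hn2 hp hq hc hβ0
      (γ := 1 / (2 * β)) (by positivity)
      (le_card_balancedSupport_of_shannonEntropy hp hpa (hN n ((le_max_left _ _).trans hn)))
    refine ⟨(measure_mono ?_).trans h, fun hn' => (measure_mono ?_).trans h⟩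
    · intro f hf hs
      exact hf <| (hs.lawEntropyGE_quarterLogLog hn2 hβ0).reverseEntropyGE
    · intro f hf hs
      exact hf <| (hs.lawEntropyGE_quarterLogLog hn2 hβ0).modelIdentifiable (hn₀ n hn') hc
  · simp only [if_neg hn]
    exact ⟨le_top, fun _ => le_top⟩

/-- Fubini: a `p` with few balanced points is charged to the simplex estimate, and for any other `p`
the bound for fixed `p` applies with `β = 4`, `γ = 1/2`. -/
theorem prod_not_hasSpreadFiber_le {n m : ℕ} (hn : 2 ≤ n) {q : Fin m → ℝ} {c : ℝ≥0}
    (hq : q ∈ stdSimplex ℝ (Fin m)) (hc : shannonEntropy q ≤ c)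
    (h1 : Real.logb 2 n ^ (-(1 / 4) : ℝ) ≤ 1) :
    (uniformSimplex n).prod (uniformMap n m) {pf | ¬ HasSpreadFiber pf.1 q pf.2
        (4 / (Real.logb 2 n ^ (1 / 2 : ℝ) * 2 ^ (-(c : ℝ))))} ≤
      ENNReal.ofReal (4 * Real.logb 2 n ^ (-(1 / 4) : ℝ) + failureBound (1 / 2) c n) := by
  have hx : 0 < Real.logb 2 n := Real.logb_pos (by norm_num) (by exact_mod_cast hn)
  have hn0 : 0 < n := by omega
  have : Nonempty (Fin n) := ⟨⟨0, hn0⟩⟩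
  have hprob := isProbabilityMeasure_uniformSimplex hn0
  have hprob' : IsProbabilityMeasure (uniformMap n m) :=
    isProbabilityMeasure_uniformOn Set.finite_univ Set.univ_nonempty
  set t := Real.logb 2 n ^ (-(1 / 4) : ℝ) with ht
  have ht0 : 0 < t := by positivity
  set M := 4 / (Real.logb 2 n ^ (1 / 2 : ℝ) * 2 ^ (-(c : ℝ))) with hM
  set few : Set (Fin n → ℝ) := {p | ((balancedSupport p t 4).card : ℝ) < 1 / 2 * n}
  set bad : Set ((Fin n → ℝ) × (Fin n → Fin m → Fin n)) := {pf | ¬ HasSpreadFiber pf.1 q pf.2 M}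
    with hbad
  have hbadm : MeasurableSet bad := by
    have hset : bad = ⋃ f : Fin n → Fin m → Fin n,
        {p : Fin n → ℝ | HasSpreadFiber p q f M}ᶜ ×ˢ {f} := by
      ext ⟨p, f⟩
      simp [hbad]
    rw [hset]
    exact MeasurableSet.iUnion fun f =>
      (measurableSet_hasSpreadFiber q f M).compl.prod (measurableSet_singleton f)
  rw [Measure.prod_apply hbadm]
  -- A measurable hull has the same measure, so measurability of `few` need not be checked.
  set few' := toMeasurable (uniformSimplex n) few
  have hfew : uniformSimplex n few' ≤ ENNReal.ofReal (4 * t) := by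
    rw [measure_toMeasurable]
    exact uniformSimplex_balancedSupport_lt_le hn ht0 h1
  have hae : ∀ᵐ p ∂uniformSimplex n, uniformMap n m (Prod.mk p ⁻¹' bad) ≤
      few'.indicator 1 p + ENNReal.ofReal (failureBound (1 / 2) c n) := by
    filter_upwards [ae_mem_stdSimplex_uniformSimplex n] with p hp
    by_cases hpf : p ∈ few'
    · rw [Set.indicator_of_mem hpf]
      exact prob_le_one.trans le_self_add
    · rw [Set.indicator_of_notMem hpf, zero_add]
      have hG : 1 / 2 * (n : ℝ) ≤ (balancedSupport p t 4).card :=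
        not_lt.1 fun h => hpf (subset_toMeasurable _ _ h)
      exact uniformMap_not_hasSpreadFiber_le_failureBound hn hp hq hc (by norm_num) (by norm_num) hG
  refine (lintegral_mono_ae hae).trans ?_
  rw [lintegral_add_right _ measurable_const,
    lintegral_indicator_one (measurableSet_toMeasurable _ _), lintegral_const, measure_univ,
    mul_one, ENNReal.ofReal_add (by positivity) (by unfold failureBound; positivity)]
  gcongr

theorem identifiable_of_uniformSimplex (c : ℝ≥0) :
    ∃ (C : ℝ) (n₀ : ℕ) (δ : ℕ → ℝ≥0∞), Tendsto δ atTop (𝓝 0) ∧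
      ∀ (n m : ℕ) (q : Fin m → ℝ), q ∈ stdSimplex ℝ (Fin m) → shannonEntropy q ≤ c →
        (uniformSimplex n).prod (uniformMap n m)
          {pf | ¬ ReverseEntropyGE pf.1 q pf.2 (quarterLogLog n C)} ≤ δ n ∧
        (n₀ ≤ n → (uniformSimplex n).prod (uniformMap n m)
          {pf | ¬ ModelIdentifiable pf.1 q pf.2 c} ≤ δ n) := by
  obtain ⟨n₀, hn₀⟩ := exists_lt_quarterLogLog c (entropyLoss 4 c)
  obtain ⟨N, hN⟩ := eventually_atTop.1
    (tendsto_logb_rpow_neg.eventually_le_const (show (0 : ℝ) < 1 by norm_num))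
  have hlim := (tendsto_logb_rpow_neg.const_mul 4).add
    (tendsto_failureBound (γ := 1 / 2) (by norm_num) c)
  rw [mul_zero, add_zero] at hlim
  refine ⟨entropyLoss 4 c, n₀, _, tendsto_ite_le_ofReal hlim (max N 2), ?_⟩
  intro n m q hq hc
  by_cases hn : max N 2 ≤ n
  · simp only [if_pos hn]
    have hn2 : 2 ≤ n := (le_max_right _ _).trans hn
    have h := prod_not_hasSpreadFiber_le hn2 hq hc (hN n ((le_max_left _ _).trans hn))
    refine ⟨(measure_mono ?_).trans h, fun hn' => (measure_mono ?_).trans h⟩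
    · intro pf hf hs
      exact hf <| (hs.lawEntropyGE_quarterLogLog hn2 (by norm_num)).reverseEntropyGE
    · intro pf hf hs
      exact hf <| (hs.lawEntropyGE_quarterLogLog hn2 (by norm_num)).modelIdentifiable (hn₀ n hn') hc
  · simp only [if_neg hn]
    exact ⟨le_top, fun _ => le_top⟩

theorem corollary1 :
    -- (a) the ratio of the largest to the smallest probability of `X` is at most `ρ`
    (∀ (ρ : ℝ) (c : ℝ≥0), ∃ (C : ℝ) (n₀ : ℕ) (δ : ℕ → ℝ≥0∞), Tendsto δ atTop (𝓝 0) ∧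
      ∀ (n m : ℕ) (p : Fin n → ℝ) (q : Fin m → ℝ),
        p ∈ stdSimplex ℝ (Fin n) → (∀ i j, p i ≤ ρ * p j) →
        q ∈ stdSimplex ℝ (Fin m) → shannonEntropy q ≤ c →
        uniformMap n m {f | ¬ ReverseEntropyGE p q f (quarterLogLog n C)} ≤ δ n ∧
        (n₀ ≤ n → uniformMap n m {f | ¬ ModelIdentifiable p q f c} ≤ δ n)) ∧
    -- (b) the distribution of `X` is sampled uniformly from the simplex, independently of `f`
    (∀ c : ℝ≥0, ∃ (C : ℝ) (n₀ : ℕ) (δ : ℕ → ℝ≥0∞), Tendsto δ atTop (𝓝 0) ∧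
      ∀ (n m : ℕ) (q : Fin m → ℝ), q ∈ stdSimplex ℝ (Fin m) → shannonEntropy q ≤ c →
        (uniformSimplex n).prod (uniformMap n m)
          {pf | ¬ ReverseEntropyGE pf.1 q pf.2 (quarterLogLog n C)} ≤ δ n ∧
        (n₀ ≤ n → (uniformSimplex n).prod (uniformMap n m)
          {pf | ¬ ModelIdentifiable pf.1 q pf.2 c} ≤ δ n)) ∧
    -- (c) the entropy of `X` is at least `log n - a`
    (∀ (a : ℝ) (c : ℝ≥0), ∃ (C : ℝ) (n₀ : ℕ) (δ : ℕ → ℝ≥0∞), Tendsto δ atTop (𝓝 0) ∧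
      ∀ (n m : ℕ) (p : Fin n → ℝ) (q : Fin m → ℝ),
        p ∈ stdSimplex ℝ (Fin n) → ENNReal.ofReal (Real.logb 2 n - a) ≤ shannonEntropy p →
        q ∈ stdSimplex ℝ (Fin m) → shannonEntropy q ≤ c →
        uniformMap n m {f | ¬ ReverseEntropyGE p q f (quarterLogLog n C)} ≤ δ n ∧
        (n₀ ≤ n → uniformMap n m {f | ¬ ModelIdentifiable p q f c} ≤ δ n)) := by
  refine ⟨fun ρ c => ?_, identifiable_of_uniformSimplex, identifiable_of_shannonEntropy_ge⟩
  -- A bounded probability ratio is an instance of large entropy, with `a = log ρ`.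
  obtain ⟨C, n₀, δ, hδ, h⟩ := identifiable_of_shannonEntropy_ge (Real.logb 2 ρ) c
  exact ⟨C, n₀, δ, hδ, fun n m p q hp hρ hq hc =>
    h n m p q hp (ofReal_logb_sub_le_shannonEntropy hp hρ) hq hc⟩
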